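/- **Problem.** Consider $F^\star=\inf_{x\in\mathcal X}F(x)$, $F=U+u$, $U(x)=\mathbb E[f(x,\xi)]$, where $\mathcal X=\{x\in\mathbb R^n: h_i(x)\le 0\ (1\le i\le I),\ g_j(x)\le 0\ (1\le j\le J)\}$, $u:\mathbb R^n\to\mathbb R\cup\{+\infty\}$ is convex and Borel measurable with $\mathcal X\subseteq\operatorname{dom}u$, the $h_i:\mathbb R^n\to\mathbb R$ are convex, and $f(\cdot,\xi)$, $g_j$, $h_i$ are $L$-smooth and $G$-Lipschitz on $\mathbb R^n$ ($L>0$, $G\ge 0$). Assume $\mathbb E\|\nabla f(x,\xi)-\nabla U(x)\|^2\le\sigma^2$ for $x\in\mathcal X$, and the strong $(\omega,\rho)$-MFCQ with $\omega,\rho>0$: for every $x\in\mathcal X$ there is a unit vector $d$ with $\langle\nabla g_j(x),d\rangle\le-\rho$ whenever $g_j(x)\ge-\omega$ and $\langle\nabla h_i(x),d\rangle\le-\rho$ whenever $h_i(x)\ge-\omega$. Let $x_1\in\mathcal X$ with $F^\star>-\infty$ and $F(x_1)-F^\star\le B_1$. **Surrogates.** For each $y\in\mathcal X$ and $\xi$: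 $\hat f(\cdot,y,\xi)$ is $\mu$-strongly convex and $L$-smooth with $\nabla\hat f(y,y,\xi)=\nabla f(y,\xi)$ (gradients in the first argument); $\tilde g_j(\cdot,y)$ is convex, $L$-smooth and $G$-Lipschitz on $\mathcal X$, $\nabla\tilde g_j(y,y)=\nabla g_j(y)$, $g_j(x)\le\tilde g_j(x,y)$ for $x\in\mathcal X$ with equality at $x=y$; and $\mathcal X(y):=\{x: h(x)\le0,\ \tilde g(x,y)\le0\}\subseteq\mathcal X$. The surrogates are jointly measurable. **Algorithm (CoSTA).** Let $\xi_1,\xi_2,\dots$ be i.i.d. copies of $\xi$, $x_0=x_1$, $z_1=\nabla f(x_0,\xi_1)$, and for $t\ge1$, with $\eta_t=\bar k\,(w+\sum_{i=1}^t\|\nabla f(x_i,\xi_i)\|^2)^{-1/3}$ (also for $t=0$) and $\beta_t=c\,\eta_{t-1}^2$, $$z_{t+1}=\nabla f(x_t,\xi_t)+(1-\beta_t)(z_t-\nabla f(x_{t-1},\xi_t)),$$ $$\hat x_t\in\arg\min_{x\in\mathcal X(x_t)}\Phi_t(x),\quad \Phi_t(x)=\hat f(x,x_t,\xi_t)+(1-\beta_t)\langle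 x-x_t,\,z_t-\nabla f(x_{t-1},\xi_t)\rangle+u(x),$$ $$x_{t+1}=(1-\eta_t)x_t+\eta_t\hat x_t,$$ where $\hat x_t$ is a measurable function of $\xi_1,\dots,\xi_t$. Assume $\Phi_t(x)-\min_{\mathcal X(x_t)}\Phi_t\le B_U$ for all $x\in\mathcal X$ and $t\ge1$. The parameters satisfy $\mu>\tfrac34$, $0<\bar k\le w^{1/3}$, $4L^2+\frac{G^2}{6L\bar k^3}<c\le\frac{w^{2/3}}{4\bar k^2}$ and $w\ge\max\{(\frac{2L\bar k}{4\mu-3})^3,G^2\}$. **$\varepsilon$-KKT points.** A random point $x\in\mathcal X$ with random multipliers $\lambda\in\mathbb R^J_+$, $\nu\in\mathbb R^I_+$ is an $\varepsilon$-KKT point in expectation if, for some random vector $v\in\partial u(x)$, $$\mathbb E\Big\|\nabla U(x)+\sum_j\lambda_j\nabla g_j(x)+\sum_i\nu_i\nabla h_i(x)+v\Big\|\le\sqrt\varepsilon,\qquad \mathbb E[\lambda^{\mathsf T}g(x)]\ge-\varepsilon,\qquad \mathbb E[\nu^{\mathsf T}h(x)]\ge-\varepsilon .$$ **Theorem.**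 There is a constant $C>0$, depending only on $L,G,\sigma,\mu,\omega,\rho,B_1,B_U,\bar k,w,c$, such that: 1. for every $\varepsilon\in(0,1)$ there are a (deterministic) $1\le t\le C\,\varepsilon^{-3/2}(1+\log\frac1\varepsilon)^{3/2}$ and random multipliers $\hat\lambda_t\in\mathbb R^J_+$, $\hat\nu_t\in\mathbb R^I_+$ such that $(\hat x_t,\hat\lambda_t,\hat\nu_t)$ is an $\varepsilon$-KKT point in expectation; the number of stochastic first-order oracle calls in the first $t$ iterations (two per iteration) obeys the same bound; 2. for every $T\ge1$ there are $1\le t\le T$ and such multipliers for which $(\hat x_t,\hat\lambda_t,\hat\nu_t)$ is an $\varepsilon_T$-KKT point in expectation with $\varepsilon_T=C\,T^{-2/3}\log(T+2)$. -/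

import Mathlib

open MeasureTheory ProbabilityTheory Set
open scoped Gradient RealInnerProductSpace

noncomputable section

namespace CoSTA

/-- Euclidean space `ℝⁿ`. -/
abbrev E (n : ℕ) := EuclideanSpace ℝ (Fin n)

/-- `φ` is differentiable at every point of `s` and its gradient is `L`-Lipschitz on `s`
(`L`-smoothness on `s`). -/
def SmoothOn {n : ℕ} (L : ℝ) (φ : E n → ℝ) (s : Set (E n)) : Prop :=
  (∀ x ∈ s, DifferentiableAt ℝ φ x) ∧ ∀ x ∈ s, ∀ y ∈ s, ‖∇ φ x - ∇ φ y‖ ≤ L * ‖x - y‖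

/-- `φ` is `G`-Lipschitz on `s`. -/
def LipOn {n : ℕ} (G : ℝ) (φ : E n → ℝ) (s : Set (E n)) : Prop :=
  ∀ x ∈ s, ∀ y ∈ s, |φ x - φ y| ≤ G * ‖x - y‖

/-- The data of the stochastic program
`min 𝔼[f(x, ξ)] + u(x)` subject to `h_i(x) ≤ 0` (`i = 1, …, I`), `g_j(x) ≤ 0` (`j = 1, …, J`).
The convex function `u` may take the value `+∞`: `dom` is its effective domain, and the values of
the real-valued function `u` off `dom` play no role. -/
structure Problem (n I J : ℕ) (Ξ : Type*) [MeasurableSpace Ξ] where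
  /-- the distribution of the random variable `ξ` -/
  law : Measure Ξ
  /-- the stochastic loss `f(x, ξ)` -/
  f : E n → Ξ → ℝ
  /-- the effective domain of `u` -/
  dom : Set (E n)
  /-- the convex part of the objective -/
  u : E n → ℝ
  /-- the convex constraint functions -/
  h : Fin I → E n → ℝ
  /-- the possibly non-convex constraint functions -/
  g : Fin J → E n → ℝ

/-- The surrogates `f̂(x, y, ξ)` and `g̃_j(x, y)`, with `y` the base point. -/
structure Surrogates (n J : ℕ) (Ξ : Type*) where
  /-- surrogate of the stochastic loss -/
  fhat : E n → E n → Ξ → ℝ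
  /-- surrogates of the non-convex constraints -/
  gtil : Fin J → E n → E n → ℝ

section Problem

variable {n I J : ℕ} {Ξ : Type*} [MeasurableSpace Ξ]

/-- `U(x) = 𝔼[f(x, ξ)]`. -/
def Problem.U (p : Problem n I J Ξ) (x : E n) : ℝ := ∫ s, p.f x s ∂p.law

/-- The objective `F = U + u` (meaningful on `dom`). -/
def Problem.F (p : Problem n I J Ξ) (x : E n) : ℝ := p.U x + p.u x

/-- The stochastic gradient `∇f(x, ξ)`, with respect to `x`: the answer of the oracle to the
query `(x, ξ)`. -/
def Problem.gradf (p : Problem n I J Ξ) (x : E n) (s : Ξ) : E n := ∇ (fun y => p.f y s) x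

/-- The convex set `{x | h(x) ≤ 0}`. -/
def Problem.K (p : Problem n I J Ξ) : Set (E n) := {x | ∀ i, p.h i x ≤ 0}

/-- The feasible region `{x | h(x) ≤ 0, g(x) ≤ 0}`. -/
def Problem.feasible (p : Problem n I J Ξ) : Set (E n) := p.K ∩ {x | ∀ j, p.g j x ≤ 0}

/-- The subdifferential `∂u(x)` of the convex function `u` at `x`. -/
def Problem.subdiff (p : Problem n I J Ξ) (x : E n) : Set (E n) :=
  {v | x ∈ p.dom ∧ ∀ y ∈ p.dom, p.u x + ⟪v, y - x⟫ ≤ p.u y}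

/-- The feasible region `{x | h(x) ≤ 0, g̃(x, y) ≤ 0}` of the convex subproblem at base point `y`. -/
def Problem.subFeasible (p : Problem n I J Ξ) (q : Surrogates n J Ξ) (y : E n) : Set (E n) :=
  p.K ∩ {x | ∀ j, q.gtil j x y ≤ 0}

/-- The strong `(ω, ρ)`-Mangasarian-Fromovitz constraint qualification at `x`: some unit vector
makes an inner product at most `-ρ` with the gradient of every `ω`-nearly active constraint. -/
def Problem.StrongMFCQ (p : Problem n I J Ξ) (ω ρ : ℝ) (x : E n) : Prop :=
  ∃ d : E n, ‖d‖ = 1 ∧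
    (∀ j, -ω ≤ p.g j x → ⟪∇ (p.g j) x, d⟫ ≤ -ρ) ∧
    (∀ i, -ω ≤ p.h i x → ⟪∇ (p.h i) x, d⟫ ≤ -ρ)

/-- The assumptions on the problem. -/
structure Problem.Regular (p : Problem n I J Ξ) (L G σ ω ρ : ℝ) : Prop where
  law_prob : IsProbabilityMeasure p.law
  f_measurable : ∀ x, Measurable (p.f x)
  f_integrable : ∀ x, Integrable (p.f x) p.law
  u_convex : ConvexOn ℝ p.dom p.u
  u_measurable : Measurable (p.dom.indicator p.u)
  h_convex : ∀ i, ConvexOn ℝ univ (p.h i)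
  /-- the problem is well defined on the feasible region -/
  feasible_subset : p.feasible ⊆ p.dom
  f_smooth : ∀ s, SmoothOn L (fun x => p.f x s) univ
  f_lipschitz : ∀ s, LipOn G (fun x => p.f x s) univ
  g_smooth : ∀ j, SmoothOn L (p.g j) univ
  g_lipschitz : ∀ j, LipOn G (p.g j) univ
  h_smooth : ∀ i, SmoothOn L (p.h i) univ
  h_lipschitz : ∀ i, LipOn G (p.h i) univ
  /-- bounded variance of the stochastic gradients -/
  variance : ∀ x ∈ p.feasible, ∫ s, ‖p.gradf x s - ∇ p.U x‖ ^ 2 ∂p.law ≤ σ ^ 2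
  mfcq : ∀ x ∈ p.feasible, p.StrongMFCQ ω ρ x

/-- The assumptions on the surrogate functions. -/
structure Surrogates.Admissible (q : Surrogates n J Ξ) (p : Problem n I J Ξ) (L G μ : ℝ) :
    Prop where
  fhat_measurable : Measurable fun a : E n × E n × Ξ => q.fhat a.1 a.2.1 a.2.2
  gtil_measurable : ∀ j, Measurable fun a : E n × E n => q.gtil j a.1 a.2
  fhat_strongConvex : ∀ y ∈ p.feasible, ∀ s, StrongConvexOn univ μ fun x => q.fhat x y s
  fhat_smooth : ∀ y ∈ p.feasible, ∀ s, SmoothOn L (fun x => q.fhat x y s) univ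
  fhat_tangent : ∀ y ∈ p.feasible, ∀ s, ∇ (fun x => q.fhat x y s) y = p.gradf y s
  gtil_convex : ∀ j, ∀ y ∈ p.feasible, ConvexOn ℝ univ fun x => q.gtil j x y
  gtil_smooth : ∀ j, ∀ y ∈ p.feasible, SmoothOn L (fun x => q.gtil j x y) p.feasible
  gtil_lipschitz : ∀ j, ∀ y ∈ p.feasible, LipOn G (fun x => q.gtil j x y) p.feasible
  gtil_tangent : ∀ j, ∀ y ∈ p.feasible, ∇ (fun x => q.gtil j x y) y = ∇ (p.g j) y
  gtil_upper : ∀ j, ∀ y ∈ p.feasible, ∀ x ∈ p.feasible, p.g j x ≤ q.gtil j x y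
  gtil_eq : ∀ j, ∀ y ∈ p.feasible, q.gtil j y y = p.g j y
  subFeasible_subset : ∀ y ∈ p.feasible, p.subFeasible q y ⊆ p.feasible

end Problem

section Algorithm

variable {n I J : ℕ} {Ξ Ω : Type*} [MeasurableSpace Ξ] [MeasurableSpace Ω]

/-- The samples `ξ_1, ξ_2, …` are independent with the distribution of the problem (the index `0`
is not used). -/
structure IIDSamples (p : Problem n I J Ξ) (Pr : Measure Ω) (ξ : ℕ → Ω → Ξ) : Prop where
  measurable : ∀ t, 1 ≤ t → Measurable (ξ t)
  law_eq : ∀ t, 1 ≤ t → Pr.map (ξ t) = p.law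
  indep : iIndepFun (fun t => ξ (t + 1)) Pr

/-- The step size `η_t = κ / (w + ∑_{i=1}^t ‖∇f(x_i, ξ_i)‖²)^{1/3}`. -/
def stepSize (p : Problem n I J Ξ) (κ w : ℝ) (ξ : ℕ → Ω → Ξ) (x : ℕ → Ω → E n) (t : ℕ) (o : Ω) :
    ℝ :=
  κ / (w + ∑ i ∈ Finset.Icc 1 t, ‖p.gradf (x i o) (ξ i o)‖ ^ 2) ^ (1 / 3 : ℝ)

/-- The momentum parameter `β_t = c η_{t-1}²`, for `t ≥ 1`. -/
def momentum (p : Problem n I J Ξ) (κ w c : ℝ) (ξ : ℕ → Ω → Ξ) (x : ℕ → Ω → E n) (t : ℕ)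
    (o : Ω) : ℝ :=
  c * stepSize p κ w ξ x (t - 1) o ^ 2

/-- The objective at `y` of the subproblem of iteration `t ≥ 1`:
`f̂(y, x_t, ξ_t) + (1 - β_t) ⟨y - x_t, z_t - ∇f(x_{t-1}, ξ_t)⟩ + u(y)`. -/
def subObjective (p : Problem n I J Ξ) (q : Surrogates n J Ξ) (κ w c : ℝ) (ξ : ℕ → Ω → Ξ)
    (x z : ℕ → Ω → E n) (t : ℕ) (o : Ω) (y : E n) : ℝ :=
  q.fhat y (x t o) (ξ t o)
    + (1 - momentum p κ w c ξ x t o) *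
        ⟪y - x t o, z t o - p.gradf (x (t - 1) o) (ξ t o)⟫
    + p.u y

/-- `x`, `xhat`, `z` are the processes `x_t`, `x̂_t`, `z_t` generated by the CoSTA algorithm with
parameters `κ, w, c`, started at `x₁` and fed with the samples `ξ`. -/
structure IsRun (p : Problem n I J Ξ) (q : Surrogates n J Ξ) (κ w c : ℝ) (x₁ : E n)
    (ξ : ℕ → Ω → Ξ) (x xhat z : ℕ → Ω → E n) : Prop where
  x_zero : ∀ o, x 0 o = x₁
  x_one : ∀ o, x 1 o = x₁
  z_one : ∀ o, z 1 o = p.gradf (x 0 o) (ξ 1 o)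
  z_succ : ∀ t, 1 ≤ t → ∀ o, z (t + 1) o = p.gradf (x t o) (ξ t o)
    + (1 - momentum p κ w c ξ x t o) • (z t o - p.gradf (x (t - 1) o) (ξ t o))
  /-- `x̂_t` solves the convex subproblem of iteration `t` … -/
  xhat_mem : ∀ t, 1 ≤ t → ∀ o, xhat t o ∈ p.subFeasible q (x t o)
  xhat_min : ∀ t, 1 ≤ t → ∀ o,
    IsMinOn (subObjective p q κ w c ξ x z t o) (p.subFeasible q (x t o)) (xhat t o)
  /-- … and is a measurable function of the samples seen so far. -/
  xhat_measurable : ∀ t, 1 ≤ t →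
    Measurable[⨆ i ∈ Set.Icc 1 t, MeasurableSpace.comap (ξ i) inferInstance] (xhat t)
  x_succ : ∀ t, 1 ≤ t → ∀ o, x (t + 1) o
    = (1 - stepSize p κ w ξ x t o) • x t o + stepSize p κ w ξ x t o • xhat t o

/-- The subproblem objectives met by the run exceed their minimum over the subproblem's feasible
region by at most `B`, at every point of the feasible region of the problem. -/
def SubObjectiveBounded (p : Problem n I J Ξ) (q : Surrogates n J Ξ) (κ w c B : ℝ)
    (ξ : ℕ → Ω → Ξ) (x z : ℕ → Ω → E n) : Prop :=
  ∀ t, 1 ≤ t → ∀ o, ∀ y ∈ p.feasible, ∀ y' ∈ p.subFeasible q (x t o),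
    subObjective p q κ w c ξ x z t o y - subObjective p q κ w c ξ x z t o y' ≤ B

/-- The queries to the stochastic first-order oracle in iterations `1, …, t`: iteration `s` asks
for `∇f(x_s, ξ_s)` and `∇f(x_{s-1}, ξ_s)`. -/
def oracleQueries (ξ : ℕ → Ω → Ξ) (x : ℕ → Ω → E n) (t : ℕ) (o : Ω) : List (E n × Ξ) :=
  (List.range t).flatMap fun s => [(x (s + 1) o, ξ (s + 1) o), (x s o, ξ (s + 1) o)]

/-- The random point `X` with the random multipliers `lam`, `nu` is an `ε`-KKT point in
expectation. -/
def IsEpsKKT (p : Problem n I J Ξ) (Pr : Measure Ω) (ε : ℝ) (X : Ω → E n) (lam : Ω → Fin J → ℝ)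
    (nu : Ω → Fin I → ℝ) : Prop :=
  Measurable X ∧ Measurable lam ∧ Measurable nu ∧
  (∀ o, X o ∈ p.feasible) ∧ (∀ o j, 0 ≤ lam o j) ∧ (∀ o i, 0 ≤ nu o i) ∧
  (∃ v : Ω → E n, Measurable v ∧ (∀ o, v o ∈ p.subdiff (X o)) ∧
    Integrable (fun o => ‖∇ p.U (X o) + ∑ j, lam o j • ∇ (p.g j) (X o)
      + ∑ i, nu o i • ∇ (p.h i) (X o) + v o‖) Pr ∧
    ∫ o, ‖∇ p.U (X o) + ∑ j, lam o j • ∇ (p.g j) (X o)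
      + ∑ i, nu o i • ∇ (p.h i) (X o) + v o‖ ∂Pr ≤ √ε) ∧
  Integrable (fun o => ∑ j, lam o j * p.g j (X o)) Pr ∧
  -ε ≤ ∫ o, ∑ j, lam o j * p.g j (X o) ∂Pr ∧
  Integrable (fun o => ∑ i, nu o i * p.h i (X o)) Pr ∧
  -ε ≤ ∫ o, ∑ i, nu o i * p.h i (X o) ∂Pr

end Algorithm

end CoSTA

end

/-!
CoSTA is a proximal method driven by a recursive momentum estimate `z_{t+1}` of `∇U(x_t)`. Write
`e_t = z_{t+1} - ∇U(x_t)` for the error of the estimate and `Δ_t = x̂_t - x_t` for the step.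

Every iterate is feasible, because `x_t` and `x̂_t` lie in the convex feasible region of the
subproblem, which is contained in the feasible region. Strong convexity of the subproblem and
smoothness of `U` give the pathwise descent inequality
`F(x_{t+1}) ≤ F(x_t) + η_t/2 ‖e_t‖² - η_t/4 ‖Δ_t‖²` (`Setting.F_succ_le`). The sample
`ξ_{t+1}` is independent of `x_t`, `x_{t+1}`, `z_{t+1}` and of the step size `η_t`, so the error
contracts in mean square by the factor `1 - β_{t+1}`, up to terms in `η_t² ‖Δ_t‖²` and in
`β_{t+1}² ‖∇f(x_{t+1}, ξ_{t+1})‖²` (`Setting.integral_gradError_succ_le`). The lower bound on `c`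
is what makes a weight `a` exist for which the potential `F(x_t) + a ‖e_t‖² / η_{t-1}` decreases in
expectation by a multiple of `η_t (‖Δ_t‖² + ‖e_t‖²)`, up to `η_t³ ‖∇f(x_{t+1}, ξ_{t+1})‖²`. These
last terms sum to `O(log T)` by the choice of the step sizes, and since the stochastic gradients are
bounded by `G` the step sizes are at least of order `T^(-1/3)`. Hence some `t ≤ T` has
`𝔼(‖Δ_t‖² + ‖e_t‖²) = O(T^(-2/3) log T)` (`Setting.exists_small_step`).

The strong Mangasarian-Fromovitz condition yields a Slater point of the subproblem whose slack
depends on the constants only (`Surrogates.Admissible.exists_slater`). Convex duality then gives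
multipliers of the subproblem whose sum is bounded by the optimality gap over the slack. Because the
surrogates are tangent at `x_t`, the same multipliers satisfy the stationarity condition of the
original problem at `x̂_t` up to `O(‖e_t‖ + ‖Δ_t‖)`, and complementary slackness up to `O(‖Δ_t‖²)`.
They have to be random variables: the KKT system of the subproblem consists of countably many affine
inequalities with measurable coefficients, as the subdifferential of `u` is cut out by a dense
sequence in the epigraph of `u`, and the solution of least norm of such a system is measurable
(`exists_measurable_selection`).
-/

noncomputable section

namespace CoSTA

/-! ### Gradients and first-order inequalities -/

section Gradients

variable {n : ℕ} {φ : E n → ℝ}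

lemma hasDerivAt_along_line {a d : E n} {t : ℝ} (hφ : DifferentiableAt ℝ φ (a + t • d)) :
    HasDerivAt (fun s : ℝ => φ (a + s • d)) ⟪∇ φ (a + t • d), d⟫ t := by
  have h1 : HasDerivAt (fun s : ℝ => a + s • d) d t := by
    simpa using ((hasDerivAt_id t).smul_const d).const_add a
  have h2 := hφ.hasGradientAt.hasFDerivAt.comp_hasDerivAt t h1
  exact h2

/-- A lower bound on the increments of `φ` along a ray, up to a quadratic error, passes to the
directional derivative. -/
lemma le_inner_gradient_of_increment {a d : E n} (hφ : DifferentiableAt ℝ φ a) {r k : ℝ}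
    (h : ∀ t : ℝ, 0 < t → t < 1 → t * r - t ^ 2 * k ≤ φ (a + t • d) - φ a) :
    r ≤ ⟪∇ φ a, d⟫ := by
  have hd : HasDerivAt (fun s : ℝ => φ (a + s • d)) ⟪∇ φ a, d⟫ 0 := by
    have := hasDerivAt_along_line (φ := φ) (a := a) (d := d) (t := 0) (by simpa using hφ)
    simpa using this
  have h1 := hd.tendsto_slope_zero_right
  have h2 : Filter.Tendsto (fun t : ℝ => r - t * k) (nhdsWithin 0 (Ioi 0)) (nhds r) := by
    have : ContinuousAt (fun t : ℝ => r - t * k) 0 := by fun_prop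
    simpa using this.tendsto.mono_left nhdsWithin_le_nhds
  refine le_of_tendsto_of_tendsto h2 h1 ?_
  filter_upwards [Ioo_mem_nhdsGT (zero_lt_one (α := ℝ))] with t ht
  have h3 := h t ht.1 ht.2
  simp only [zero_add, zero_smul, add_zero, smul_eq_mul]
  rw [inv_mul_eq_div, le_div_iff₀ ht.1]
  nlinarith

lemma gradient_neg' (a : E n) : ∇ (fun y => -φ y) a = -∇ φ a := by
  unfold gradient
  rw [show (fun y => -φ y) = -φ from rfl, fderiv_neg, map_neg]

lemma SmoothOn.neg {L : ℝ} {s : Set (E n)} (h : SmoothOn L φ s) : SmoothOn L (fun y => -φ y) s := by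
  refine ⟨fun x hx => (h.1 x hx).neg, fun x hx y hy => ?_⟩
  rw [gradient_neg', gradient_neg', neg_sub_neg, ← norm_neg, neg_sub]
  exact h.2 x hx y hy

/-- The descent lemma. Smoothness is needed only along the segment. -/
lemma SmoothOn.le_quadratic {L : ℝ} {s : Set (E n)} (h : SmoothOn L φ s) {a d : E n}
    (hs : ∀ t ∈ Icc (0 : ℝ) 1, a + t • d ∈ s) :
    φ (a + d) ≤ φ a + ⟪∇ φ a, d⟫ + L / 2 * ‖d‖ ^ 2 := by
  set ψ : ℝ → ℝ := fun t => φ (a + t • d) - t * ⟪∇ φ a, d⟫ - L / 2 * ‖d‖ ^ 2 * t ^ 2 with hψ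
  have hder : ∀ t ∈ Icc (0 : ℝ) 1, HasDerivAt ψ
      (⟪∇ φ (a + t • d), d⟫ - ⟪∇ φ a, d⟫ - L * ‖d‖ ^ 2 * t) t := by
    intro t ht
    have h1 := hasDerivAt_along_line (h.1 _ (hs t ht))
    have h2 := (hasDerivAt_id t).mul_const ⟪∇ φ a, d⟫
    have h3 := ((hasDerivAt_id t).pow 2).const_mul (L / 2 * ‖d‖ ^ 2)
    refine ((h1.sub h2).sub h3).congr_deriv ?_
    simp; ring
  have hanti : AntitoneOn ψ (Icc 0 1) := by
    refine antitoneOn_of_deriv_nonpos (convex_Icc 0 1)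
      (fun t ht => (hder t ht).continuousAt.continuousWithinAt)
      (fun t ht => (hder t (interior_subset ht)).differentiableAt.differentiableWithinAt) ?_
    intro t ht
    have ht' := interior_subset ht
    rw [(hder t ht').deriv, ← inner_sub_left]
    have h1 := real_inner_le_norm (∇ φ (a + t • d) - ∇ φ a) d
    have h0 : a ∈ s := by simpa using hs 0 (by simp)
    have h2 := h.2 _ (hs t ht') _ h0
    rw [add_sub_cancel_left, norm_smul, Real.norm_of_nonneg ht'.1] at h2
    have h3 := mul_le_mul_of_nonneg_right h2 (norm_nonneg d)
    nlinarith
  have := hanti (by simp : (0 : ℝ) ∈ Icc (0 : ℝ) 1) (by simp : (1 : ℝ) ∈ Icc (0 : ℝ) 1) zero_le_one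
  simp only [hψ, one_smul, zero_smul, add_zero, one_mul, zero_mul] at this
  linarith

lemma SmoothOn.quadratic_le {L : ℝ} {s : Set (E n)} (h : SmoothOn L φ s) {a d : E n}
    (hs : ∀ t ∈ Icc (0 : ℝ) 1, a + t • d ∈ s) :
    φ a + ⟪∇ φ a, d⟫ - L / 2 * ‖d‖ ^ 2 ≤ φ (a + d) := by
  have := h.neg.le_quadratic hs
  rw [gradient_neg', inner_neg_left] at this
  linarith

lemma LipOn.norm_gradient_le {G : ℝ} (hG : 0 ≤ G) (h : LipOn G φ univ) (a : E n) :
    ‖∇ φ a‖ ≤ G := by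
  have hl : LipschitzWith ⟨G, hG⟩ φ := LipschitzWith.of_dist_le_mul fun x y => by
    rw [Real.dist_eq, dist_eq_norm]; exact h x trivial y trivial
  have := norm_fderiv_le_of_lipschitz ℝ hl (x₀ := a)
  unfold gradient
  rw [LinearIsometryEquiv.norm_map]
  exact this

lemma LipOn.continuous {G : ℝ} (hG : 0 ≤ G) (h : LipOn G φ univ) : Continuous φ := by
  have hl : LipschitzWith ⟨G, hG⟩ φ := LipschitzWith.of_dist_le_mul fun x y => by
    rw [Real.dist_eq, dist_eq_norm]; exact h x trivial y trivial
  exact hl.continuous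

lemma SmoothOn.continuous_gradient {L : ℝ} (hL : 0 ≤ L) (h : SmoothOn L φ univ) :
    Continuous (∇ φ) := by
  have hl : LipschitzWith ⟨L, hL⟩ (∇ φ) := LipschitzWith.of_dist_le_mul fun x y => by
    rw [dist_eq_norm, dist_eq_norm]; exact h.2 x trivial y trivial
  exact hl.continuous

/-- The first-order characterization of strong convexity. -/
lemma strongConvexOn_gradient_le {μ : ℝ} (h : StrongConvexOn univ μ φ) {a : E n}
    (hφ : DifferentiableAt ℝ φ a) (b : E n) :
    φ a + ⟪∇ φ a, b - a⟫ + μ / 2 * ‖b - a‖ ^ 2 ≤ φ b := by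
  have key : -(φ b - φ a - μ / 2 * ‖b - a‖ ^ 2) ≤ ⟪∇ (fun y => -φ y) a, b - a⟫ := by
    refine le_inner_gradient_of_increment hφ.neg (k := μ / 2 * ‖b - a‖ ^ 2) fun t h0 h1 => ?_
    have := h.2 (mem_univ b) (mem_univ a) h0.le (by linarith : (0 : ℝ) ≤ 1 - t) (by ring)
    have e : a + t • (b - a) = t • b + (1 - t) • a := by module
    rw [e]
    simp only [smul_eq_mul, Pi.neg_apply] at this ⊢
    nlinarith
  rw [gradient_neg', inner_neg_left] at key
  linarith

/-- First-order optimality: a minimizer over a convex set of a sum of a differentiable and a convex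
function minimizes the sum of the linearized and the convex function. -/
lemma le_add_inner_gradient_of_isMinOn {u : E n → ℝ} {s : Set (E n)} {a : E n} (ha : a ∈ s)
    (hmin : IsMinOn (fun y => φ y + u y) s a) (hφ : DifferentiableAt ℝ φ a)
    (hu : ConvexOn ℝ s u) {b : E n} (hb : b ∈ s) :
    u a ≤ u b + ⟪∇ φ a, b - a⟫ := by
  have key : u a - u b ≤ ⟪∇ φ a, b - a⟫ := by
    refine le_inner_gradient_of_increment hφ (k := 0) fun t h0 h1 => ?_
    have h2 := hu.2 hb ha h0.le (by linarith : (0 : ℝ) ≤ 1 - t) (by ring)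
    have e : a + t • (b - a) = t • b + (1 - t) • a := by module
    have hm : t • b + (1 - t) • a ∈ s := hu.1 hb ha h0.le (by linarith) (by ring)
    have h3 := isMinOn_iff.1 hmin _ hm
    rw [e]
    simp only [smul_eq_mul] at h2
    nlinarith
  linarith

/-- The gradient at a moving point is measurable as a limit of difference quotients. -/
lemma measurable_gradient_of_increments {Ω : Type*} [MeasurableSpace Ω] {ψ : Ω → E n → ℝ}
    {a : Ω → E n} (hd : ∀ o, DifferentiableAt ℝ (ψ o) (a o))
    (hm : ∀ d : E n, Measurable fun o => ψ o (a o + d)) :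
    Measurable fun o => ∇ (ψ o) (a o) := by
  have hc : ∀ i, Measurable fun o => (∇ (ψ o) (a o)) i := by
    intro i
    set d : E n := EuclideanSpace.single i 1 with hddef
    have hlim : ∀ o, Filter.Tendsto
        (fun k : ℕ => ((1 : ℝ) / (k + 1))⁻¹ * (ψ o (a o + ((1 : ℝ) / (k + 1)) • d) - ψ o (a o + 0)))
        Filter.atTop (nhds ((∇ (ψ o) (a o)) i)) := by
      intro o
      have h1 : HasDerivAt (fun s : ℝ => ψ o (a o + s • d)) ⟪∇ (ψ o) (a o), d⟫ 0 := by
        have := hasDerivAt_along_line (φ := ψ o) (a := a o) (d := d) (t := 0)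
          (by simpa using hd o)
        simpa using this
      have h2 := h1.tendsto_slope_zero_right
      have h3 : Filter.Tendsto (fun k : ℕ => (1 : ℝ) / (k + 1)) Filter.atTop
          (nhdsWithin 0 (Ioi 0)) :=
        tendsto_nhdsWithin_iff.2 ⟨tendsto_one_div_add_atTop_nhds_zero_nat,
          Filter.Eventually.of_forall fun k => by simp only [mem_Ioi]; positivity⟩
      have h4 := h2.comp h3
      have h5 : ⟪∇ (ψ o) (a o), d⟫ = (∇ (ψ o) (a o)) i := by
        rw [hddef, EuclideanSpace.inner_single_right]; simp
      rw [h5] at h4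
      refine h4.congr fun k => ?_
      simp
    refine measurable_of_tendsto_metrizable (fun k => ?_) (tendsto_pi_nhds.2 hlim)
    exact ((hm _).sub (hm _)).const_mul _
  exact (WithLp.measurable_toLp 2 (Fin n → ℝ)).comp (measurable_pi_lambda _ hc)

end Gradients

/-! ### The expected loss and its stochastic gradients -/

section ExpectedLoss

variable {n I J : ℕ} {Ξ : Type*} [MeasurableSpace Ξ] {p : Problem n I J Ξ} {L G σ ω ρ : ℝ}

lemma Problem.Regular.norm_gradf_le (hp : p.Regular L G σ ω ρ) (hG : 0 ≤ G) (x : E n) (s : Ξ) :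
    ‖p.gradf x s‖ ≤ G :=
  (hp.f_lipschitz s).norm_gradient_le hG x

lemma Problem.Regular.norm_gradf_sub_le (hp : p.Regular L G σ ω ρ) (x y : E n) (s : Ξ) :
    ‖p.gradf x s - p.gradf y s‖ ≤ L * ‖x - y‖ :=
  (hp.f_smooth s).2 x trivial y trivial

lemma Problem.Regular.measurable_f (hp : p.Regular L G σ ω ρ) (hG : 0 ≤ G) :
    Measurable fun a : E n × Ξ => p.f a.1 a.2 :=
  measurable_uncurry_of_continuous_of_measurable (u := p.f)
    (fun s => (hp.f_lipschitz s).continuous hG) hp.f_measurable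

lemma Problem.Regular.measurable_gradf (hp : p.Regular L G σ ω ρ) (hG : 0 ≤ G) :
    Measurable fun a : E n × Ξ => p.gradf a.1 a.2 := by
  refine measurable_gradient_of_increments (ψ := fun a : E n × Ξ => fun y => p.f y a.2)
    (a := fun a => a.1) (fun a => (hp.f_smooth a.2).1 _ trivial) fun d => ?_
  exact (hp.measurable_f hG).comp (f := fun a : E n × Ξ => (a.1 + d, a.2)) (by fun_prop)

lemma Problem.Regular.integrable_gradf (hp : p.Regular L G σ ω ρ) (hG : 0 ≤ G) (x : E n) :
    Integrable (p.gradf x) p.law := by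
  have := hp.law_prob
  refine Integrable.of_bound ((hp.measurable_gradf hG).comp measurable_prodMk_left).aestronglyMeasurable G ?_
  exact Filter.Eventually.of_forall fun s => hp.norm_gradf_le hG x s

lemma Problem.Regular.hasGradientAt_U (hp : p.Regular L G σ ω ρ) (hG : 0 ≤ G) (x : E n) :
    HasGradientAt p.U (∫ s, p.gradf x s ∂p.law) x := by
  have := hp.law_prob
  have hd : ∀ s, HasFDerivAt (fun y => p.f y s) (InnerProductSpace.toDual ℝ (E n) (p.gradf x s)) x :=
    fun s => ((hp.f_smooth s).1 x trivial).hasGradientAt.hasFDerivAt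
  have hint : Integrable (fun s => InnerProductSpace.toDual ℝ (E n) (p.gradf x s)) p.law :=
    (InnerProductSpace.toDual ℝ (E n)).toContinuousLinearEquiv.toContinuousLinearMap.integrable_comp
      (hp.integrable_gradf hG x)
  have h := hasFDerivAt_integral_of_dominated_loc_of_lip (μ := p.law) (𝕜 := ℝ)
    (F := fun y s => p.f y s) (x₀ := x) (bound := fun _ => G) (s := univ)
    (F' := fun s => InnerProductSpace.toDual ℝ (E n) (p.gradf x s)) Filter.univ_mem
    (Filter.Eventually.of_forall fun y => (hp.f_measurable y).aestronglyMeasurable)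
    (hp.f_integrable x) hint.aestronglyMeasurable
    (Filter.Eventually.of_forall fun s => LipschitzWith.lipschitzOnWith <|
      LipschitzWith.of_dist_le_mul fun y y' => by
        rw [Real.dist_eq, dist_eq_norm, Real.coe_nnabs, abs_of_nonneg hG]
        exact hp.f_lipschitz s y trivial y' trivial)
    (integrable_const _) (Filter.Eventually.of_forall hd)
  have h2 : InnerProductSpace.toDual ℝ (E n) (∫ s, p.gradf x s ∂p.law)
      = ∫ s, InnerProductSpace.toDual ℝ (E n) (p.gradf x s) ∂p.law :=
    ((InnerProductSpace.toDual ℝ (E n)).toContinuousLinearEquiv.toContinuousLinearMap.integral_comp_comm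
      (hp.integrable_gradf hG x)).symm
  rw [hasGradientAt_iff_hasFDerivAt, h2]
  exact h.2

lemma Problem.Regular.gradient_U (hp : p.Regular L G σ ω ρ) (hG : 0 ≤ G) (x : E n) :
    ∇ p.U x = ∫ s, p.gradf x s ∂p.law :=
  (hp.hasGradientAt_U hG x).gradient

lemma Problem.Regular.norm_gradient_U_le (hp : p.Regular L G σ ω ρ) (hG : 0 ≤ G) (x : E n) :
    ‖∇ p.U x‖ ≤ G := by
  have := hp.law_prob
  rw [hp.gradient_U hG]
  simpa using norm_integral_le_of_norm_le_const (μ := p.law)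
    (Filter.Eventually.of_forall fun s => hp.norm_gradf_le hG x s)

lemma Problem.Regular.smoothOn_U (hp : p.Regular L G σ ω ρ) (hG : 0 ≤ G) :
    SmoothOn L p.U univ := by
  have := hp.law_prob
  refine ⟨fun x _ => (hp.hasGradientAt_U hG x).differentiableAt, fun x _ y _ => ?_⟩
  rw [hp.gradient_U hG, hp.gradient_U hG,
    ← integral_sub (hp.integrable_gradf hG x) (hp.integrable_gradf hG y)]
  simpa using norm_integral_le_of_norm_le_const (μ := p.law)
    (Filter.Eventually.of_forall fun s => hp.norm_gradf_sub_le x y s)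

end ExpectedLoss

/-! ### Multipliers for convex programs -/

section Duality

/-- Convex Lagrange duality under Slater's condition, by separating the origin from the open convex
set of strict upper bounds for the values of the objective and of the constraints. -/
lemma exists_convex_multipliers {V ι : Type*} [AddCommGroup V] [Module ℝ V] [Fintype ι]
    {D : Set V} {θ : V → ℝ} {c : ι → V → ℝ} (hθ : ConvexOn ℝ D θ) (hc : ∀ k, ConvexOn ℝ D (c k))
    (hmin : ∀ y ∈ D, (∀ k, c k y ≤ 0) → 0 ≤ θ y) {xs : V} (hxs : xs ∈ D)
    (hslater : ∀ k, c k xs < 0) :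
    ∃ l : ι → ℝ, (∀ k, 0 ≤ l k) ∧ ∀ y ∈ D, 0 ≤ θ y + ∑ k, l k * c k y := by
  classical
  set W : Set (ℝ × (ι → ℝ)) := {w | ∃ y ∈ D, θ y < w.1 ∧ ∀ k, c k y < w.2 k} with hW
  have hWconv : Convex ℝ W := by
    rintro ⟨r, a⟩ ⟨y, hy, hr, ha⟩ ⟨r', a'⟩ ⟨y', hy', hr', ha'⟩ α β hα hβ hαβ
    refine ⟨α • y + β • y', hθ.1 hy hy' hα hβ hαβ, ?_, fun k => ?_⟩
    · refine (hθ.2 hy hy' hα hβ hαβ).trans_lt ?_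
      simp only [smul_eq_mul, Prod.fst_add, Prod.smul_fst] at *
      rcases hα.eq_or_lt with h | h
      · have : β = 1 := by linarith
        subst h; subst this; linarith
      · nlinarith [mul_lt_mul_of_pos_left hr h, mul_le_mul_of_nonneg_left hr'.le hβ]
    · refine ((hc k).2 hy hy' hα hβ hαβ).trans_lt ?_
      have h1 := ha k
      have h2 := ha' k
      simp only [smul_eq_mul, Prod.snd_add, Prod.smul_snd, Pi.add_apply, Pi.smul_apply] at *
      rcases hα.eq_or_lt with h | h
      · have : β = 1 := by linarith
        subst h; subst this; linarith
      · nlinarith [mul_lt_mul_of_pos_left h1 h, mul_le_mul_of_nonneg_left h2.le hβ]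
  have hWopen : IsOpen W := by
    have : W = ⋃ y ∈ D, {w : ℝ × (ι → ℝ) | θ y < w.1 ∧ ∀ k, c k y < w.2 k} := by
      ext w; simp only [hW, mem_ofPred_eq, mem_iUnion, exists_prop]
    rw [this]
    refine isOpen_biUnion fun y _ => ?_
    rw [ofPred_and, ofPred_forall]
    refine (isOpen_lt continuous_const continuous_fst).inter (isOpen_iInter_of_finite fun k => ?_)
    exact isOpen_lt continuous_const ((continuous_apply k).comp continuous_snd)
  have h0 : (0 : ℝ × (ι → ℝ)) ∉ W := by
    rintro ⟨y, hy, hr, ha⟩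
    exact absurd (hmin y hy fun k => (ha k).le) (not_le.2 hr)
  obtain ⟨f, hf⟩ := geometric_hahn_banach_open_point hWconv hWopen h0
  rw [map_zero] at hf
  set α : ℝ := -f (1, 0) with hα
  set l : ι → ℝ := fun k => -f (0, Pi.single k 1) with hl
  have hfw : ∀ r a, f (r, a) = -(r * α + ∑ k, a k * l k) := by
    intro r a
    have e : ((r, a) : ℝ × (ι → ℝ)) = r • (1, 0) + ∑ k, a k • ((0 : ℝ), (Pi.single k 1 : ι → ℝ)) := by
      ext i
      · simp [Prod.fst_sum]
      · simp [Prod.snd_sum, Finset.sum_apply, Pi.single_apply]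
    rw [e, map_add, map_sum]
    simp only [map_smul, smul_eq_mul, hα, hl, mul_neg, Finset.sum_neg_distrib]
    ring
  set R : ℝ := max (θ xs) 0 + 1 with hR
  have hR1 : θ xs < R := by have := le_max_left (θ xs) 0; linarith
  have hR0 : 0 < R := by have := le_max_right (θ xs) 0; linarith
  have hαpos : 0 < α := by
    have := hf (R, 0) ⟨xs, hxs, hR1, fun k => by simpa using hslater k⟩
    rw [hfw] at this
    simp only [Pi.zero_apply, zero_mul, Finset.sum_const_zero, add_zero] at this
    by_contra h
    nlinarith
  have hlnn : ∀ k, 0 ≤ l k := by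
    intro k
    have hN : ∀ N : ℝ, 0 ≤ N → 0 < R * α + N * l k := by
      intro N hN
      have := hf (R, Pi.single k N) ⟨xs, hxs, hR1, fun i => by
        refine (hslater i).trans_le ?_
        by_cases hi : i = k
        · subst hi; simpa using hN
        · simp [hi]⟩
      rw [hfw] at this
      simp only [Pi.single_apply, ite_mul, zero_mul, Finset.sum_ite_eq', Finset.mem_univ,
        if_true] at this
      linarith
    by_contra h
    push Not at h
    have := hN (R * α / (-l k)) (by apply div_nonneg <;> nlinarith)
    rw [div_mul_eq_mul_div, mul_div_assoc, div_neg, div_self h.ne] at this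
    linarith
  have hmain : ∀ y ∈ D, 0 ≤ θ y * α + ∑ k, c k y * l k := by
    intro y hy
    have hε : ∀ ε : ℝ, 0 < ε → 0 ≤ θ y * α + ∑ k, c k y * l k + ε * (α + ∑ k, l k) := by
      intro ε hε
      have := hf (θ y + ε, fun k => c k y + ε) ⟨y, hy, by simpa using hε, fun k => by simpa using hε⟩
      rw [hfw] at this
      simp only [add_mul, Finset.sum_add_distrib, ← Finset.mul_sum] at this
      linarith
    have hs : 0 ≤ ∑ k, l k := Finset.sum_nonneg fun k _ => hlnn k
    by_contra h
    push Not at h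
    have := hε (-(θ y * α + ∑ k, c k y * l k) / (2 * (α + ∑ k, l k)))
      (div_pos (by linarith) (by linarith))
    have hpos : 0 < α + ∑ k, l k := by linarith
    rw [div_mul_eq_mul_div, mul_div_mul_right _ _ hpos.ne'] at this
    linarith
  refine ⟨fun k => l k / α, fun k => div_nonneg (hlnn k) hαpos.le, fun y hy => ?_⟩
  have h1 := div_nonneg (hmain y hy) hαpos.le
  rw [add_div, mul_div_cancel_right₀ _ hαpos.ne', Finset.sum_div] at h1
  refine h1.trans_eq ?_
  congr 1
  exact Finset.sum_congr rfl fun k _ => by ring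

/-- Karush-Kuhn-Tucker multipliers for `min φ + u` over `{c ≤ 0}`, with the bound on their sum that
comes from a Slater point. -/
lemma exists_kkt_multipliers {n : ℕ} {ι : Type*} [Fintype ι] {D : Set (E n)} {φ u : E n → ℝ}
    {c : ι → E n → ℝ} {a xs : E n} {s : ℝ} (hu : ConvexOn ℝ D u) (hc : ∀ k, ConvexOn ℝ univ (c k))
    (hD : {y | ∀ k, c k y ≤ 0} ⊆ D) (ha : ∀ k, c k a ≤ 0) (hφ : DifferentiableAt ℝ φ a)
    (hcd : ∀ k, DifferentiableAt ℝ (c k) a)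
    (hmin : IsMinOn (fun y => φ y + u y) {y | ∀ k, c k y ≤ 0} a) (hs : 0 < s)
    (hxs : ∀ k, c k xs ≤ -s) :
    ∃ l : ι → ℝ, (∀ k, 0 ≤ l k) ∧ (∀ k, l k * c k a = 0) ∧
      (∑ k, l k) * s ≤ u xs - u a + ⟪∇ φ a, xs - a⟫ ∧
      ∀ y ∈ D, u a + ⟪-(∇ φ a + ∑ k, l k • ∇ (c k) a), y - a⟫ ≤ u y := by
  have hcD : ∀ k, ConvexOn ℝ D (c k) := fun k => (hc k).subset (subset_univ _) hu.1
  have haD : a ∈ D := hD ha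
  have hxsD : xs ∈ D := hD fun k => (hxs k).trans (by linarith)
  have hA : Convex ℝ {y | ∀ k, c k y ≤ 0} := by
    rw [ofPred_forall]
    exact convex_iInter fun k => by simpa using (hc k).convex_le 0
  have hlin : ConvexOn ℝ D fun y => ⟪∇ φ a, y - a⟫ := by
    refine ⟨hu.1, fun x _ y _ α β _ _ hαβ => le_of_eq ?_⟩
    have : α • x + β • y - a = α • (x - a) + β • (y - a) := by
      rw [smul_sub, smul_sub, sub_add_sub_comm, ← add_smul, hαβ, one_smul]
    change ⟪∇ φ a, α • x + β • y - a⟫ = α * ⟪∇ φ a, x - a⟫ + β * ⟪∇ φ a, y - a⟫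
    rw [this, inner_add_right, inner_smul_right, inner_smul_right]
  have hθ : ConvexOn ℝ D fun y => u y + ⟪∇ φ a, y - a⟫ + -u a := (hu.add hlin).add_const (-u a)
  obtain ⟨l, hl, hL⟩ := exists_convex_multipliers hθ hcD (fun y hy hy' => by
    have := le_add_inner_gradient_of_isMinOn (s := {y | ∀ k, c k y ≤ 0}) ha hmin hφ
      (hu.subset hD hA) hy'
    linarith) hxsD (fun k => (hxs k).trans_lt (by linarith))
  have hcomp : ∀ k, l k * c k a = 0 := by
    have h1 := hL a haD
    simp only [sub_self, inner_zero_right, add_zero, add_neg_cancel, zero_add] at h1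
    have h2 : ∀ k ∈ Finset.univ, l k * c k a ≤ 0 := fun k _ =>
      mul_nonpos_of_nonneg_of_nonpos (hl k) (ha k)
    have h3 := (Finset.sum_eq_zero_iff_of_nonpos h2).1 (le_antisymm (Finset.sum_nonpos h2) h1)
    exact fun k => h3 k (Finset.mem_univ k)
  refine ⟨l, hl, hcomp, ?_, fun y hy => ?_⟩
  · have h1 := hL xs hxsD
    have h2 : ∑ k, l k * c k xs ≤ ∑ k, l k * (-s) :=
      Finset.sum_le_sum fun k _ => mul_le_mul_of_nonneg_left (hxs k) (hl k)
    rw [← Finset.sum_mul] at h2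
    linarith
  · -- the minimality of `a` for the Lagrangian is linearized in the constraints
    have key : u a - u y - ⟪∇ φ a, y - a⟫ ≤ ⟪∑ k, l k • ∇ (c k) a, y - a⟫ := by
      have hdiff : HasGradientAt (fun y => ∑ k, l k * c k y) (∑ k, l k • ∇ (c k) a) a := by
        rw [hasGradientAt_iff_hasFDerivAt, map_sum]
        refine HasFDerivAt.fun_sum fun k _ => ?_
        rw [map_smul]
        exact (hcd k).hasGradientAt.hasFDerivAt.const_mul (l k)
      rw [← hdiff.gradient]
      refine le_inner_gradient_of_increment hdiff.differentiableAt (k := 0) fun t h0 h1 => ?_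
      have e : a + t • (y - a) = t • y + (1 - t) • a := by module
      have hm : a + t • (y - a) ∈ D := by
        rw [e]; exact hu.1 hy haD h0.le (by linarith) (by ring)
      have h2 := hL _ hm
      have h3 := hu.2 hy haD h0.le (by linarith : (0 : ℝ) ≤ 1 - t) (by ring)
      rw [← e] at h3
      simp only [add_sub_cancel_left, inner_smul_right, smul_eq_mul] at h2 h3
      have h4 : ∑ k, l k * c k a = 0 := Finset.sum_eq_zero fun k _ => hcomp k
      rw [h4]
      nlinarith
    rw [inner_neg_left, inner_add_left]
    linarith

end Duality

/-! ### Measurable selection -/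

section Selection

open Filter Topology

/-- A convex-valued measurable selection theorem: the set of common solutions of countably many
inequalities, measurable in the parameter and continuous in the unknown, has a measurable selection
as soon as it is always nonempty and convex. The selection is the element of least norm, which is
the limit of approximate minimizers, taken from a fixed dense sequence, of penalized norms. -/
lemma exists_measurable_selection {Ω Θ ι : Type*} [MeasurableSpace Ω] [Countable ι] [Nonempty ι]
    [NormedAddCommGroup Θ] [InnerProductSpace ℝ Θ] [FiniteDimensional ℝ Θ] [MeasurableSpace Θ]
    [BorelSpace Θ] (ψ : ι → Ω → Θ → ℝ) (hm : ∀ k θ, Measurable fun o => ψ k o θ)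
    (hcont : ∀ k o, Continuous (ψ k o)) (hconv : ∀ o, Convex ℝ {θ | ∀ k, ψ k o θ ≤ 0})
    (hne : ∀ o, ∃ θ, ∀ k, ψ k o θ ≤ 0) :
    ∃ sel : Ω → Θ, Measurable sel ∧ ∀ o k, ψ k o (sel o) ≤ 0 := by
  classical
  have : ProperSpace Θ := FiniteDimensional.proper_real Θ
  obtain ⟨enum, henum⟩ := exists_surjective_nat ι
  have hleast : ∀ o, ∃ θ, (∀ k, ψ k o θ ≤ 0) ∧ ∀ θ', (∀ k, ψ k o θ' ≤ 0) → ‖θ'‖ ≤ ‖θ‖ → θ' = θ := by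
    intro o
    have hclosed : IsClosed {θ | ∀ k, ψ k o θ ≤ 0} := by
      rw [ofPred_forall]
      exact isClosed_iInter fun k => isClosed_le (hcont k o) continuous_const
    obtain ⟨θ, hθ, hmin⟩ := exists_norm_eq_iInf_of_complete_convex (hne o) hclosed.isComplete
      (hconv o) 0
    refine ⟨θ, hθ, fun θ' hθ' hle => ?_⟩
    have h1 := (norm_eq_iInf_iff_real_inner_le_zero (hconv o) hθ).1 hmin θ' hθ'
    rw [zero_sub, inner_neg_left, inner_sub_right, real_inner_self_eq_norm_sq] at h1
    have h2 := norm_sub_sq_real θ' θ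
    rw [real_inner_comm] at h2
    have h3 : ‖θ'‖ ^ 2 ≤ ‖θ‖ ^ 2 := by gcongr
    have h4 : ‖θ' - θ‖ ^ 2 ≤ 0 := by linarith
    have h5 : ‖θ' - θ‖ = 0 := by
      have := sq_nonneg ‖θ' - θ‖
      exact pow_eq_zero_iff (two_ne_zero) |>.1 (le_antisymm h4 this)
    exact sub_eq_zero.1 (norm_eq_zero.1 h5)
  choose best hbest hbest' using hleast
  set pen : ℕ → Ω → Θ → ℝ := fun m o θ =>
    ‖θ‖ ^ 2 + m * ∑ k ∈ Finset.range m, max 0 (ψ (enum k) o θ) with hpen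
  have hpen0 : ∀ m o θ, ‖θ‖ ^ 2 ≤ pen m o θ := fun m o θ => by
    have : 0 ≤ ∑ k ∈ Finset.range m, max 0 (ψ (enum k) o θ) :=
      Finset.sum_nonneg fun k _ => le_max_left _ _
    have := mul_nonneg (Nat.cast_nonneg (α := ℝ) m) this
    simp only [hpen]; linarith
  set d := TopologicalSpace.denseSeq Θ with hd
  have hpenm : ∀ m θ, Measurable fun o => pen m o θ := fun m θ =>
    ((Finset.measurable_sum _ fun k _ => measurable_const.max (hm _ θ)).const_mul _).const_add _
  have hpenc : ∀ m o, Continuous (pen m o) := fun m o =>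
    (continuous_norm.pow 2).add (continuous_const.mul
      (continuous_finsetSum _ fun k _ => continuous_const.max (hcont _ o)))
  have hbdd : ∀ m o, BddBelow (range fun i => pen m o (d i)) := fun m o =>
    ⟨0, by rintro _ ⟨i, rfl⟩; exact (sq_nonneg _).trans (hpen0 m o _)⟩
  have hfind : ∀ m o, ∃ i, pen m o (d i) < (⨅ i, pen m o (d i)) + 1 / (m + 1) := fun m o =>
    exists_lt_of_ciInf_lt (lt_add_of_pos_right _ (by positivity))
  set q : ℕ → Ω → Θ := fun m o => d (Nat.find (hfind m o)) with hq
  have hqm : ∀ m, Measurable (q m) := fun m =>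
    (measurable_from_nat (f := d)).comp (measurable_find (hfind m) fun i =>
      measurableSet_lt (hpenm m _) ((Measurable.iInf fun i => hpenm m _).add_const _))
  have hqle : ∀ m o, pen m o (q m o) ≤ ‖best o‖ ^ 2 + 1 / (m + 1) := by
    intro m o
    refine (Nat.find_spec (hfind m o)).le.trans (add_le_add_left ?_ _)
    have hb : pen m o (best o) = ‖best o‖ ^ 2 := by
      simp only [hpen]
      rw [Finset.sum_eq_zero fun k _ => max_eq_left (hbest o _)]
      simp
    rw [← hb]
    refine le_of_forall_gt_imp_ge_of_dense fun r hr => ?_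
    obtain ⟨i, hi⟩ := (TopologicalSpace.denseRange_denseSeq Θ).exists_mem_open
      ((isOpen_Iio (a := r)).preimage (hpenc m o)) ⟨best o, hr⟩
    exact (ciInf_le (hbdd m o) i).trans (le_of_lt hi)
  have hinv : ∀ m : ℕ, (1 : ℝ) / (m + 1) ≤ 1 := fun m => by
    rw [div_le_one (by positivity)]; linarith [(Nat.cast_nonneg m : (0 : ℝ) ≤ m)]
  have hlim : ∀ o, Tendsto (fun m => q m o) atTop (𝓝 (best o)) := by
    intro o
    refine tendsto_of_subseq_tendsto fun ns hns => ?_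
    have hbd : ∀ m, q m o ∈ Metric.closedBall (0 : Θ) (‖best o‖ + 1) := by
      intro m
      rw [mem_closedBall_zero_iff]
      have h1 := (hpen0 m o (q m o)).trans (hqle m o)
      have h2 := hinv m
      refine abs_le_of_sq_le_sq' ?_ (by positivity) |>.2
      nlinarith [norm_nonneg (best o)]
    obtain ⟨θ, -, ms, hms, hθ⟩ :=
      tendsto_subseq_of_bounded Metric.isBounded_closedBall fun m => hbd (ns m)
    refine ⟨ms, ?_⟩
    have hto : Tendsto (fun m => ns (ms m)) atTop atTop := hns.comp hms.tendsto_atTop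
    have hθ' : Tendsto (fun m => q (ns (ms m)) o) atTop (𝓝 θ) := hθ
    have h1 : θ = best o := by
      refine hbest' o θ (fun k => ?_) ?_
      · obtain ⟨k, rfl⟩ := henum k
        have h2 : Tendsto (fun m => max 0 (ψ (enum k) o (q (ns (ms m)) o))) atTop
            (𝓝 (max 0 (ψ (enum k) o θ))) :=
          ((continuous_const.max (hcont (enum k) o)).tendsto θ).comp hθ'
        have h3 : Tendsto (fun m => (‖best o‖ ^ 2 + 1) / ((ns (ms m) : ℕ) : ℝ)) atTop (𝓝 0) :=
          tendsto_const_nhds.div_atTop (tendsto_natCast_atTop_atTop.comp hto)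
        have h4 : max 0 (ψ (enum k) o θ) ≤ 0 := by
          refine le_of_tendsto_of_tendsto h2 h3 ?_
          filter_upwards [hto.eventually_gt_atTop k] with m hmk
          set N := ns (ms m) with hN
          have hNpos : (0 : ℝ) < N := by exact_mod_cast (Nat.zero_le k).trans_lt hmk
          rw [le_div_iff₀ hNpos]
          have h5 : max 0 (ψ (enum k) o (q N o))
              ≤ ∑ k ∈ Finset.range N, max 0 (ψ (enum k) o (q N o)) :=
            Finset.single_le_sum (f := fun k => max 0 (ψ (enum k) o (q N o)))
              (fun k _ => le_max_left _ _) (Finset.mem_range.2 hmk)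
          have h6 := hqle N o
          simp only [hpen] at h6
          have h7 := hinv N
          nlinarith [sq_nonneg ‖q N o‖, mul_le_mul_of_nonneg_left h5 hNpos.le]
        exact (le_max_right _ _).trans h4
      · have h2 : Tendsto (fun m => ‖q (ns (ms m)) o‖ ^ 2) atTop (𝓝 (‖θ‖ ^ 2)) :=
          (hθ'.norm).pow 2
        have h3 : Tendsto (fun m => ‖best o‖ ^ 2 + 1 / (((ns (ms m) : ℕ) : ℝ) + 1)) atTop
            (𝓝 (‖best o‖ ^ 2 + 0)) :=
          tendsto_const_nhds.add (tendsto_one_div_add_atTop_nhds_zero_nat.comp hto)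
        rw [add_zero] at h3
        have h4 := le_of_tendsto_of_tendsto h2 h3 (Eventually.of_forall fun m =>
          (hpen0 _ o _).trans (hqle _ o))
        exact (pow_le_pow_iff_left₀ (norm_nonneg _) (norm_nonneg _) two_ne_zero).1 h4
    rw [← h1]
    exact hθ'
  exact ⟨best, measurable_of_tendsto_metrizable hqm (tendsto_pi_nhds.2 hlim), hbest⟩

/-- Countably many points of the epigraph of `u` determine its affine minorants, since they can be
taken dense in the epigraph. -/
lemma exists_countable_epigraph {n : ℕ} {D : Set (E n)} (hD : D.Nonempty) (u : E n → ℝ) :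
    ∃ d : ℕ → E n × ℝ, ∀ (r : ℝ) (a v : E n),
      (∀ y ∈ D, r + ⟪v, y - a⟫ ≤ u y) ↔ ∀ k, r + ⟪v, (d k).1 - a⟫ - (d k).2 ≤ 0 := by
  set S : Set (E n × ℝ) := {w | w.1 ∈ D ∧ u w.1 ≤ w.2} with hS
  obtain ⟨y0, hy0⟩ := hD
  have : Nonempty S := ⟨⟨(y0, u y0), hy0, le_rfl⟩⟩
  refine ⟨fun k => (TopologicalSpace.denseSeq S k : E n × ℝ), fun r a v => ⟨fun h k => ?_, fun h y hy => ?_⟩⟩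
  · have hk := (TopologicalSpace.denseSeq S k).2
    have := h _ hk.1
    linarith [hk.2]
  · have hcl : IsClosed {w : S | r + ⟪v, (w : E n × ℝ).1 - a⟫ - (w : E n × ℝ).2 ≤ 0} :=
      isClosed_le (by fun_prop) continuous_const
    have hall := hcl.closure_subset_iff.2 (range_subset_iff.2 h)
    have := hall (TopologicalSpace.denseRange_denseSeq S ⟨(y, u y), hy, le_rfl⟩)
    simp only [mem_ofPred_eq] at this
    linarith

end Selection

/-! ### The convex subproblem -/

section Subproblem

variable {n I J : ℕ} {Ξ : Type*} [MeasurableSpace Ξ] {p : Problem n I J Ξ} {q : Surrogates n J Ξ}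
  {L G σ ω ρ μ : ℝ}

/-- The constraint functions of the subproblem at base point `y`, the surrogates of the `g_j` and
the `h_i` in a single family. -/
def subConstraint (p : Problem n I J Ξ) (q : Surrogates n J Ξ) (y : E n) (k : Fin J ⊕ Fin I)
    (x : E n) : ℝ :=
  Sum.elim (fun j => q.gtil j x y) (fun i => p.h i x) k

/-- The smooth part `f̂(x, y, s) + ⟨x - y, b⟩` of a subproblem objective at base point `y`. -/
def subSmooth (q : Surrogates n J Ξ) (y b : E n) (s : Ξ) (x : E n) : ℝ :=
  q.fhat x y s + ⟪x - y, b⟫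

lemma subFeasible_eq (p : Problem n I J Ξ) (q : Surrogates n J Ξ) (y : E n) :
    p.subFeasible q y = {x | ∀ k, subConstraint p q y k x ≤ 0} := by
  ext x
  simp only [Problem.subFeasible, Problem.K, subConstraint, mem_inter_iff, mem_ofPred_eq,
    Sum.forall, Sum.elim_inl, Sum.elim_inr]
  exact and_comm

variable {y : E n}

lemma Surrogates.Admissible.subConstraint_convex (hq : q.Admissible p L G μ)
    (hp : p.Regular L G σ ω ρ) (hy : y ∈ p.feasible) (k : Fin J ⊕ Fin I) :
    ConvexOn ℝ univ (subConstraint p q y k) := by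
  rcases k with j | i
  · exact hq.gtil_convex j y hy
  · exact hp.h_convex i

lemma Surrogates.Admissible.subFeasible_convex (hq : q.Admissible p L G μ)
    (hp : p.Regular L G σ ω ρ) (hy : y ∈ p.feasible) : Convex ℝ (p.subFeasible q y) := by
  rw [subFeasible_eq, ofPred_forall]
  exact convex_iInter fun k => by simpa using (hq.subConstraint_convex hp hy k).convex_le 0

lemma Surrogates.Admissible.mem_subFeasible_self (hq : q.Admissible p L G μ)
    (hy : y ∈ p.feasible) : y ∈ p.subFeasible q y :=
  ⟨hy.1, fun j => (hq.gtil_eq j y hy).trans_le (hy.2 j)⟩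

lemma Surrogates.Admissible.subConstraint_differentiableAt (hq : q.Admissible p L G μ)
    (hp : p.Regular L G σ ω ρ) (hy : y ∈ p.feasible) {x : E n} (hx : x ∈ p.feasible)
    (k : Fin J ⊕ Fin I) : DifferentiableAt ℝ (subConstraint p q y k) x := by
  rcases k with j | i
  · exact (hq.gtil_smooth j y hy).1 x hx
  · exact (hp.h_smooth i).1 x trivial

lemma Surrogates.Admissible.hasGradientAt_subSmooth (hq : q.Admissible p L G μ)
    (hy : y ∈ p.feasible) (s : Ξ) (b x : E n) :
    HasGradientAt (subSmooth q y b s) (∇ (fun x => q.fhat x y s) x + b) x := by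
  rw [hasGradientAt_iff_hasFDerivAt, map_add]
  refine ((hq.fhat_smooth y hy s).1 x trivial).hasGradientAt.hasFDerivAt.add ?_
  have h : HasFDerivAt (fun x : E n => ⟪b, x - y⟫) (InnerProductSpace.toDual ℝ (E n) b) x :=
    ((InnerProductSpace.toDual ℝ (E n) b).hasFDerivAt).comp x ((hasFDerivAt_id x).sub_const y)
  simpa only [real_inner_comm] using h

/-- A step of length `τ` along a direction of descent for the nearly active constraints decreases
every constraint function below a fixed negative level. -/
lemma le_neg_min_of_nearly_active {ψ : E n → ℝ} {S : Set (E n)} {d : E n} {τ : ℝ} (hL : 0 < L)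
    (hG : 0 ≤ G) (hsm : SmoothOn L ψ S) (hlip : LipOn G ψ S) (hd : ‖d‖ = 1)
    (hψ : ψ y ≤ 0) (hact : -ω ≤ ψ y → ⟪∇ ψ y, d⟫ ≤ -ρ) (hτ : 0 ≤ τ) (hτ1 : τ ≤ ρ / L)
    (hτ2 : τ ≤ ω / (2 * G + 1)) (hS : ∀ t ∈ Icc (0 : ℝ) 1, y + t • (τ • d) ∈ S) :
    ψ (y + τ • d) ≤ -min (τ * ρ / 2) (ω / 2) := by
  have hnorm : ‖τ • d‖ = τ := by rw [norm_smul, hd, mul_one, Real.norm_of_nonneg hτ]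
  by_cases h : -ω ≤ ψ y
  · have h1 := hsm.le_quadratic hS
    rw [hnorm, inner_smul_right] at h1
    have h2 := mul_le_mul_of_nonneg_left (hact h) hτ
    rw [le_div_iff₀ hL] at hτ1
    have h3 := mul_le_mul_of_nonneg_left hτ1 hτ
    have h4 := min_le_left (τ * ρ / 2) (ω / 2)
    nlinarith
  · have h0 : y ∈ S := by simpa using hS 0 (by simp)
    have h1 : y + τ • d ∈ S := by simpa using hS 1 (by simp)
    have h2 := (le_abs_self _).trans (hlip _ h1 _ h0)
    rw [add_sub_cancel_left, hnorm] at h2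
    rw [le_div_iff₀ (by linarith)] at hτ2
    have h4 := min_le_right (τ * ρ / 2) (ω / 2)
    nlinarith

/-- The slack of the Slater points that the strong Mangasarian-Fromovitz condition provides. -/
def slaterSlack (L G ω ρ : ℝ) : ℝ :=
  min (min (ρ / L) (ω / (2 * G + 1)) * ρ / 2) (ω / 2)

lemma slaterSlack_pos (hL : 0 < L) (hG : 0 ≤ G) (hω : 0 < ω) (hρ : 0 < ρ) :
    0 < slaterSlack L G ω ρ := by
  unfold slaterSlack
  positivity

/-- Slater points with uniform slack. The segment from the base point to the Slater point stays
feasible, which is what makes the smoothness of the surrogates available along it. -/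
lemma Surrogates.Admissible.exists_slater (hq : q.Admissible p L G μ) (hp : p.Regular L G σ ω ρ)
    (hL : 0 < L) (hG : 0 ≤ G) (hω : 0 < ω) (hρ : 0 < ρ) (hy : y ∈ p.feasible) :
    ∃ xs ∈ p.feasible, ∀ k, subConstraint p q y k xs ≤ -slaterSlack L G ω ρ := by
  obtain ⟨d, hd, hdg, hdh⟩ := hp.mfcq y hy
  set τ := min (ρ / L) (ω / (2 * G + 1)) with hτ
  have hτ0 : 0 < τ := by positivity
  have hfeas : ∀ t ∈ Icc (0 : ℝ) 1, y + t • (τ • d) ∈ p.feasible := by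
    intro t ht
    rw [smul_smul]
    have h0 : 0 ≤ t * τ := mul_nonneg ht.1 hτ0.le
    have hle : t * τ ≤ τ := mul_le_of_le_one_left hτ0.le ht.2
    have h1 : t * τ ≤ ρ / L := hle.trans (min_le_left _ _)
    have h2 : t * τ ≤ ω / (2 * G + 1) := hle.trans (min_le_right _ _)
    have hneg : -min (t * τ * ρ / 2) (ω / 2) ≤ 0 := neg_nonpos.2 (by positivity)
    exact ⟨fun i => (le_neg_min_of_nearly_active hL hG (hp.h_smooth i) (hp.h_lipschitz i) hd
        (hy.1 i) (hdh i) h0 h1 h2 fun _ _ => trivial).trans hneg,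
      fun j => (le_neg_min_of_nearly_active hL hG (hp.g_smooth j) (hp.g_lipschitz j) hd
        (hy.2 j) (hdg j) h0 h1 h2 fun _ _ => trivial).trans hneg⟩
  refine ⟨y + τ • d, by simpa using hfeas 1 (by simp), ?_⟩
  rintro (j | i)
  · refine le_neg_min_of_nearly_active hL hG (hq.gtil_smooth j y hy) (hq.gtil_lipschitz j y hy) hd
      ?_ ?_ hτ0.le (min_le_left _ _) (min_le_right _ _) hfeas
    · exact (hq.gtil_eq j y hy).trans_le (hy.2 j)
    · intro h
      have h1 : -ω ≤ q.gtil j y y := h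
      rw [hq.gtil_eq j y hy] at h1
      exact (congrArg (⟪·, d⟫) (hq.gtil_tangent j y hy)).trans_le (hdg j h1)
  · exact le_neg_min_of_nearly_active hL hG (hp.h_smooth i) (hp.h_lipschitz i) hd (hy.1 i)
      (hdh i) hτ0.le (min_le_left _ _) (min_le_right _ _) fun _ _ => trivial

variable {s : Ξ} {b xh : E n}

lemma Surrogates.Admissible.subFeasible_subset_dom (hq : q.Admissible p L G μ)
    (hp : p.Regular L G σ ω ρ) (hy : y ∈ p.feasible) : p.subFeasible q y ⊆ p.dom :=
  (hq.subFeasible_subset y hy).trans hp.feasible_subset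

/-- First-order optimality of the solution of the subproblem. -/
lemma Surrogates.Admissible.u_le_of_isMinOn (hq : q.Admissible p L G μ) (hp : p.Regular L G σ ω ρ)
    (hy : y ∈ p.feasible) (hxh : xh ∈ p.subFeasible q y)
    (hmin : IsMinOn (fun x => subSmooth q y b s x + p.u x) (p.subFeasible q y) xh) :
    p.u xh ≤ p.u y + ⟪∇ (fun x => q.fhat x y s) xh + b, y - xh⟫ := by
  have hg := hq.hasGradientAt_subSmooth hy s b xh
  have := le_add_inner_gradient_of_isMinOn hxh hmin hg.differentiableAt
    (hp.u_convex.subset (hq.subFeasible_subset_dom hp hy) (hq.subFeasible_convex hp hy))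
    (hq.mem_subFeasible_self hy)
  rwa [hg.gradient] at this

/-- The step `xh - y` is a descent direction, up to the error of the gradient estimate
`∇f(y, s) + b`. -/
lemma Surrogates.Admissible.inner_step_le (hq : q.Admissible p L G μ) (hp : p.Regular L G σ ω ρ)
    (hy : y ∈ p.feasible) (hxh : xh ∈ p.subFeasible q y)
    (hmin : IsMinOn (fun x => subSmooth q y b s x + p.u x) (p.subFeasible q y) xh) :
    ⟪p.gradf y s + b, xh - y⟫ + p.u xh - p.u y ≤ -(μ * ‖xh - y‖ ^ 2) := by
  have h1 := hq.u_le_of_isMinOn hp hy hxh hmin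
  have hd := (hq.fhat_smooth y hy s).1
  have h2 := strongConvexOn_gradient_le (hq.fhat_strongConvex y hy s) (hd xh trivial) y
  have h3 := strongConvexOn_gradient_le (hq.fhat_strongConvex y hy s) (hd y trivial) xh
  rw [hq.fhat_tangent y hy s] at h3
  rw [norm_sub_rev] at h2
  have e : y - xh = -(xh - y) := by abel
  rw [e, inner_neg_right, inner_add_left] at h1
  rw [e, inner_neg_right] at h2
  rw [inner_add_left]
  linarith

lemma Surrogates.Admissible.norm_step_sq_le (hq : q.Admissible p L G μ) (hp : p.Regular L G σ ω ρ)
    (hy : y ∈ p.feasible) (hxh : xh ∈ p.subFeasible q y)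
    (hmin : IsMinOn (fun x => subSmooth q y b s x + p.u x) (p.subFeasible q y) xh) :
    μ / 2 * ‖xh - y‖ ^ 2 ≤ (subSmooth q y b s y + p.u y) - (subSmooth q y b s xh + p.u xh) := by
  have h1 := hq.u_le_of_isMinOn hp hy hxh hmin
  have h2 := strongConvexOn_gradient_le (hq.fhat_strongConvex y hy s)
    ((hq.fhat_smooth y hy s).1 xh trivial) y
  rw [norm_sub_rev, show y - xh = -(xh - y) by abel, inner_neg_right] at h2
  rw [show y - xh = -(xh - y) by abel, inner_neg_right, inner_add_left] at h1
  simp only [subSmooth, sub_self, inner_zero_left]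
  have e : ⟪b, xh - y⟫ = ⟪xh - y, b⟫ := real_inner_comm _ _
  linarith

/-- Multipliers of the subproblem, bounded in terms of the optimality gap. -/
lemma Surrogates.Admissible.exists_multipliers {B : ℝ} (hq : q.Admissible p L G μ)
    (hp : p.Regular L G σ ω ρ) (hL : 0 < L) (hG : 0 ≤ G) (hμ : 0 ≤ μ) (hω : 0 < ω) (hρ : 0 < ρ)
    (hy : y ∈ p.feasible) (hxh : xh ∈ p.subFeasible q y)
    (hmin : IsMinOn (fun x => subSmooth q y b s x + p.u x) (p.subFeasible q y) xh)
    (hB : ∀ x ∈ p.feasible, (subSmooth q y b s x + p.u x) - (subSmooth q y b s xh + p.u xh) ≤ B) :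
    ∃ l : Fin J ⊕ Fin I → ℝ, (∀ k, 0 ≤ l k) ∧ (∀ k, l k * subConstraint p q y k xh = 0) ∧
      ∑ k, l k ≤ B / slaterSlack L G ω ρ ∧
      ∀ x ∈ p.dom, p.u xh + ⟪-(∇ (fun x => q.fhat x y s) xh + b
        + ∑ k, l k • ∇ (subConstraint p q y k) xh), x - xh⟫ ≤ p.u x := by
  obtain ⟨xs, hxs, hslack⟩ := hq.exists_slater hp hL hG hω hρ hy
  have hg := hq.hasGradientAt_subSmooth hy s b xh
  have hpos := slaterSlack_pos hL hG hω hρ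
  rw [subFeasible_eq] at hmin
  obtain ⟨l, hl, hcomp, hsum, hsub⟩ := exists_kkt_multipliers hp.u_convex
    (hq.subConstraint_convex hp hy)
    (by rw [← subFeasible_eq]; exact hq.subFeasible_subset_dom hp hy)
    (by rw [subFeasible_eq] at hxh; exact hxh) hg.differentiableAt
    (hq.subConstraint_differentiableAt hp hy (hq.subFeasible_subset y hy hxh)) hmin hpos hslack
  rw [hg.gradient] at hsum hsub
  refine ⟨l, hl, hcomp, ?_, hsub⟩
  rw [le_div_iff₀ hpos]
  refine hsum.trans (le_trans ?_ (hB xs hxs))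
  have h2 := strongConvexOn_gradient_le (hq.fhat_strongConvex y hy s)
    ((hq.fhat_smooth y hy s).1 xh trivial) xs
  have h3 : 0 ≤ μ / 2 * ‖xs - xh‖ ^ 2 := by positivity
  have e : ⟪b, xs - xh⟫ = ⟪xs - y, b⟫ - ⟪xh - y, b⟫ := by
    rw [← inner_sub_left, sub_sub_sub_cancel_right, real_inner_comm]
  rw [inner_add_left, e]
  simp only [subSmooth]
  linarith

/-- Multipliers of the subproblem make the residual of the stationarity condition of the original
problem small when the step and the error of the gradient estimate are small. -/
lemma Surrogates.Admissible.norm_residual_le {l : Fin J ⊕ Fin I → ℝ} {Λ : ℝ}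
    (hq : q.Admissible p L G μ) (hp : p.Regular L G σ ω ρ) (hL : 0 < L) (hG : 0 ≤ G)
    (hy : y ∈ p.feasible) (hxh : xh ∈ p.feasible) (hl : ∀ k, 0 ≤ l k) (hΛ : ∑ k, l k ≤ Λ) :
    ‖∇ p.U xh + ∑ j, l (Sum.inl j) • ∇ (p.g j) xh + ∑ i, l (Sum.inr i) • ∇ (p.h i) xh
      + -(∇ (fun x => q.fhat x y s) xh + b + ∑ k, l k • ∇ (subConstraint p q y k) xh)‖
      ≤ ‖p.gradf y s + b - ∇ p.U y‖ + (2 * L + 2 * L * Λ) * ‖xh - y‖ := by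
  have hsplit : ∑ k, l k • ∇ (subConstraint p q y k) xh
      = ∑ j, l (Sum.inl j) • ∇ (fun x => q.gtil j x y) xh
        + ∑ i, l (Sum.inr i) • ∇ (p.h i) xh := Fintype.sum_sum_type _
  have hdec : ∇ p.U xh + ∑ j, l (Sum.inl j) • ∇ (p.g j) xh + ∑ i, l (Sum.inr i) • ∇ (p.h i) xh
      + -(∇ (fun x => q.fhat x y s) xh + b + ∑ k, l k • ∇ (subConstraint p q y k) xh)
      = -(p.gradf y s + b - ∇ p.U y) + (∇ p.U xh - ∇ p.U y)
        - (∇ (fun x => q.fhat x y s) xh - ∇ (fun x => q.fhat x y s) y)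
        + ∑ j, l (Sum.inl j) • ((∇ (p.g j) xh - ∇ (p.g j) y)
          - (∇ (fun x => q.gtil j x y) xh - ∇ (fun x => q.gtil j x y) y)) := by
    have h1 : ∑ j, l (Sum.inl j) • ((∇ (p.g j) xh - ∇ (p.g j) y)
          - (∇ (fun x => q.gtil j x y) xh - ∇ (fun x => q.gtil j x y) y))
        = ∑ j, l (Sum.inl j) • ∇ (p.g j) xh
          - ∑ j, l (Sum.inl j) • ∇ (fun x => q.gtil j x y) xh := by
      rw [← Finset.sum_sub_distrib]
      refine Finset.sum_congr rfl fun j _ => ?_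
      rw [hq.gtil_tangent j y hy, sub_sub_sub_cancel_right, smul_sub]
    rw [h1, hsplit, hq.fhat_tangent y hy s]
    abel
  rw [hdec]
  have hlj : ∑ j, l (Sum.inl j) ≤ Λ := by
    refine le_trans ?_ hΛ
    rw [Fintype.sum_sum_type]
    exact le_add_of_nonneg_right (Finset.sum_nonneg fun i _ => hl _)
  have hN : ‖∑ j, l (Sum.inl j) • ((∇ (p.g j) xh - ∇ (p.g j) y)
      - (∇ (fun x => q.gtil j x y) xh - ∇ (fun x => q.gtil j x y) y))‖
      ≤ 2 * L * Λ * ‖xh - y‖ := by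
    refine (norm_sum_le _ _).trans ?_
    have : ∀ j ∈ Finset.univ, ‖l (Sum.inl j) • ((∇ (p.g j) xh - ∇ (p.g j) y)
        - (∇ (fun x => q.gtil j x y) xh - ∇ (fun x => q.gtil j x y) y))‖
        ≤ l (Sum.inl j) * (2 * L * ‖xh - y‖) := by
      intro j _
      rw [norm_smul, Real.norm_of_nonneg (hl _)]
      refine mul_le_mul_of_nonneg_left ((norm_sub_le _ _).trans ?_) (hl _)
      have h1 := (hp.g_smooth j).2 xh trivial y trivial
      have h2 := (hq.gtil_smooth j y hy).2 xh hxh y hy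
      linarith
    refine (Finset.sum_le_sum this).trans ?_
    rw [← Finset.sum_mul]
    have := mul_le_mul_of_nonneg_right hlj (by positivity : 0 ≤ 2 * L * ‖xh - y‖)
    linarith
  have h1 := (hp.smoothOn_U hG).2 xh trivial y trivial
  have h2 := (hq.fhat_smooth y hy s).2 xh trivial y trivial
  refine (norm_add_le _ _).trans ?_
  have h3 := norm_sub_le (-(p.gradf y s + b - ∇ p.U y) + (∇ p.U xh - ∇ p.U y))
    (∇ (fun x => q.fhat x y s) xh - ∇ (fun x => q.fhat x y s) y)
  have h4 := norm_add_le (-(p.gradf y s + b - ∇ p.U y)) (∇ p.U xh - ∇ p.U y)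
  rw [norm_neg] at h4
  linarith

/-- Approximate complementary slackness: `g_j` and its surrogate differ by a quadratic term along
the step. -/
lemma Surrogates.Admissible.sum_mul_g_ge {l : Fin J ⊕ Fin I → ℝ} {Λ : ℝ}
    (hq : q.Admissible p L G μ) (hp : p.Regular L G σ ω ρ) (hL : 0 < L)
    (hy : y ∈ p.feasible) (hxh : xh ∈ p.subFeasible q y) (hl : ∀ k, 0 ≤ l k) (hΛ : ∑ k, l k ≤ Λ)
    (hcomp : ∀ k, l k * subConstraint p q y k xh = 0) :
    -(L * Λ * ‖xh - y‖ ^ 2) ≤ ∑ j, l (Sum.inl j) * p.g j xh := by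
  have hlj : ∑ j, l (Sum.inl j) ≤ Λ := by
    refine le_trans ?_ hΛ
    rw [Fintype.sum_sum_type]
    exact le_add_of_nonneg_right (Finset.sum_nonneg fun i _ => hl _)
  have hseg : ∀ t ∈ Icc (0 : ℝ) 1, y + t • (xh - y) ∈ p.feasible := fun t ht =>
    hq.subFeasible_subset y hy ((hq.subFeasible_convex hp hy).add_smul_sub_mem
      (hq.mem_subFeasible_self hy) hxh ht)
  have hj : ∀ j, q.gtil j xh y - L * ‖xh - y‖ ^ 2 ≤ p.g j xh := by
    intro j
    have h1 := (hq.gtil_smooth j y hy).le_quadratic hseg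
    have h2 := (hp.g_smooth j).quadratic_le (a := y) (d := xh - y) fun _ _ => trivial
    rw [add_sub_cancel, hq.gtil_tangent j y hy, hq.gtil_eq j y hy] at h1
    rw [add_sub_cancel] at h2
    linarith
  calc -(L * Λ * ‖xh - y‖ ^ 2) ≤ -((∑ j, l (Sum.inl j)) * (L * ‖xh - y‖ ^ 2)) := by
        have := mul_le_mul_of_nonneg_right hlj (by positivity : 0 ≤ L * ‖xh - y‖ ^ 2)
        linarith
    _ = ∑ j, l (Sum.inl j) * (q.gtil j xh y - L * ‖xh - y‖ ^ 2) := by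
        simp only [mul_sub, Finset.sum_sub_distrib, Finset.sum_mul]
        have h0 : ∑ j, l (Sum.inl j) * q.gtil j xh y = 0 :=
          Finset.sum_eq_zero fun j _ => hcomp (Sum.inl j)
        rw [h0, zero_sub]
    _ ≤ _ := Finset.sum_le_sum fun j _ => mul_le_mul_of_nonneg_left (hj j) (hl _)

/-- Multipliers can be selected measurably. -/
lemma exists_measurable_multipliers {Ω κ : Type*} [MeasurableSpace Ω] [Fintype κ] {D : Set (E n)}
    {u : E n → ℝ} {a v : Ω → E n} {c : κ → Ω → ℝ} {w : κ → Ω → E n} {Λ : ℝ} (hD : D.Nonempty)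
    (ha : Measurable a) (hu : Measurable fun o => u (a o)) (hv : Measurable v)
    (hc : ∀ k, Measurable (c k)) (hw : ∀ k, Measurable (w k)) (hc0 : ∀ k o, c k o ≤ 0)
    (hex : ∀ o, ∃ l : κ → ℝ, (∀ k, 0 ≤ l k) ∧ (∀ k, l k * c k o = 0) ∧ ∑ k, l k ≤ Λ ∧
      ∀ x ∈ D, u (a o) + ⟪-(v o + ∑ k, l k • w k o), x - a o⟫ ≤ u x) :
    ∃ l : Ω → κ → ℝ, Measurable l ∧ ∀ o, (∀ k, 0 ≤ l o k) ∧ (∀ k, l o k * c k o = 0) ∧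
      ∑ k, l o k ≤ Λ ∧ ∀ x ∈ D, u (a o) + ⟪-(v o + ∑ k, l o k • w k o), x - a o⟫ ≤ u x := by
  obtain ⟨d, hd⟩ := exists_countable_epigraph hD u
  set ψ : (κ ⊕ κ) ⊕ (Unit ⊕ ℕ) → Ω → EuclideanSpace ℝ κ → ℝ := fun m o l =>
    Sum.elim (Sum.elim (fun k => -l k) (fun k => -(l k * c k o)))
      (Sum.elim (fun _ => ∑ k, l k - Λ)
        (fun i => u (a o) + ⟪-(v o + ∑ k, l k • w k o), (d i).1 - a o⟫ - (d i).2)) m with hψ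
  have hiff : ∀ o (l : EuclideanSpace ℝ κ), (∀ m, ψ m o l ≤ 0) ↔ (∀ k, 0 ≤ l k) ∧
      (∀ k, l k * c k o = 0) ∧ ∑ k, l k ≤ Λ ∧
      ∀ x ∈ D, u (a o) + ⟪-(v o + ∑ k, l k • w k o), x - a o⟫ ≤ u x := by
    intro o l
    simp only [hψ, Sum.forall, Sum.elim_inl, Sum.elim_inr, hd, forall_const, Left.neg_nonpos_iff,
      sub_nonpos]
    constructor
    · rintro ⟨⟨h1, h2⟩, h3, h4⟩
      exact ⟨h1, fun k => le_antisymm (mul_nonpos_of_nonneg_of_nonpos (h1 k) (hc0 k o)) (h2 k),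
        h3, h4⟩
    · rintro ⟨h1, h2, h3, h4⟩
      exact ⟨⟨h1, fun k => (h2 k).ge⟩, h3, h4⟩
  have hsel : ∃ sel : Ω → EuclideanSpace ℝ κ, Measurable sel ∧ ∀ o m, ψ m o (sel o) ≤ 0 := by
    refine exists_measurable_selection ψ ?_ ?_ ?_ ?_
    · rintro ((k | k) | (_ | i)) l <;> simp only [hψ, Sum.elim_inl, Sum.elim_inr]
      · exact measurable_const
      · exact ((hc k).const_mul _).neg
      · exact measurable_const
      · have h1 : Measurable fun o => ∑ k, l k • w k o :=
          Finset.measurable_sum _ fun k _ => (hw k).const_smul (l k)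
        exact (hu.add (Measurable.inner (hv.add h1).neg (measurable_const.sub ha))).sub_const _
    · rintro ((k | k) | (_ | i)) o <;> simp only [hψ, Sum.elim_inl, Sum.elim_inr] <;> fun_prop
    · intro o l hl l' hl' α β hα hβ hαβ
      have haff : ∀ m, ψ m o (α • l + β • l') = α * ψ m o l + β * ψ m o l' := by
        rintro ((k | k) | (_ | i)) <;> simp only [hψ, Sum.elim_inl, Sum.elim_inr]
        · simp; ring
        · simp; ring
        · simp only [PiLp.add_apply, PiLp.smul_apply, smul_eq_mul, Finset.sum_add_distrib,
            ← Finset.mul_sum]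
          linear_combination Λ * hαβ
        · simp only [PiLp.add_apply, PiLp.smul_apply, smul_eq_mul, add_smul, mul_smul,
            Finset.sum_add_distrib, ← Finset.smul_sum, inner_neg_left, inner_add_left,
            real_inner_smul_left]
          linear_combination (-u (a o) + ⟪v o, (d i).1 - a o⟫ + (d i).2) * hαβ
      intro m
      rw [haff]
      have h1 := mul_le_mul_of_nonneg_left (hl m) hα
      have h2 := mul_le_mul_of_nonneg_left (hl' m) hβ
      linarith
    · intro o
      obtain ⟨l, hl⟩ := hex o
      exact ⟨WithLp.toLp 2 l, (hiff o _).2 hl⟩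
  obtain ⟨sel, hsel, hsel'⟩ := hsel
  exact ⟨fun o k => sel o k, measurable_pi_lambda _ fun k =>
    (measurable_pi_apply k).comp ((WithLp.measurable_ofLp 2 (κ → ℝ)).comp hsel),
    fun o => (hiff o (sel o)).1 (hsel' o)⟩

end Subproblem

/-! ### The parameters of the algorithm -/

section Parameters

/-- The conditions on the numerical parameters. -/
structure Params (L G μ κ w c : ℝ) : Prop where
  L_pos : 0 < L
  G_nonneg : 0 ≤ G
  μ_gt : 3 / 4 < μ
  κ_pos : 0 < κ
  κ_le : κ ≤ w ^ (1 / 3 : ℝ)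
  c_upper : c ≤ w ^ (2 / 3 : ℝ) / (4 * κ ^ 2)
  c_lower : 4 * L ^ 2 + G ^ 2 / (6 * L * κ ^ 3) < c
  w_lower : max ((2 * L * κ / (4 * μ - 3)) ^ 3) (G ^ 2) ≤ w

variable {L G μ κ w c : ℝ}

lemma rpow_one_third_cube {a : ℝ} (ha : 0 ≤ a) : (a ^ (1 / 3 : ℝ)) ^ 3 = a := by
  rw [← Real.rpow_natCast, ← Real.rpow_mul ha]; norm_num

namespace Params

variable (P : Params L G μ κ w c)
include P

lemma w_pos : 0 < w := by
  have h1 := P.L_pos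
  have h2 := P.κ_pos
  have h3 : 0 < 4 * μ - 3 := by linarith [P.μ_gt]
  exact lt_of_lt_of_le (by positivity) ((le_max_left _ _).trans P.w_lower)

lemma G_sq_le : G ^ 2 ≤ w := (le_max_right _ _).trans P.w_lower

lemma c_pos : 0 < c := by
  have h1 := P.L_pos
  have h2 := P.κ_pos
  exact lt_of_le_of_lt (by positivity) P.c_lower

lemma root_pos : 0 < w ^ (1 / 3 : ℝ) := Real.rpow_pos_of_pos P.w_pos _

lemma c_mul_le : 4 * (c * κ ^ 2) ≤ (w ^ (1 / 3 : ℝ)) ^ 2 := by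
  have h1 := P.c_upper
  have h2 := P.κ_pos
  have h3 : w ^ (2 / 3 : ℝ) = (w ^ (1 / 3 : ℝ)) ^ 2 := by
    rw [← Real.rpow_natCast, ← Real.rpow_mul P.w_pos.le]; norm_num
  rw [le_div_iff₀ (by positivity), h3] at h1
  linarith

/-- The initial step size is less than `1 / (4L)`, by the two bounds on `c`. -/
lemma four_mul_lt : 4 * L * κ < w ^ (1 / 3 : ℝ) := by
  have h1 := P.L_pos
  have h2 := P.κ_pos
  have h3 : 4 * L ^ 2 < c := lt_of_le_of_lt (le_add_of_nonneg_right (by positivity)) P.c_lower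
  have h4 := mul_lt_mul_of_pos_right h3 (by positivity : 0 < κ ^ 2)
  have h5 := P.c_mul_le
  refine lt_of_pow_lt_pow_left₀ 2 P.root_pos.le ?_
  nlinarith

lemma L_mul_le : L * κ ≤ (2 * μ - 3 / 2) * w ^ (1 / 3 : ℝ) := by
  have h3 : 0 < 4 * μ - 3 := by linarith [P.μ_gt]
  have h1 := (le_max_left _ _).trans P.w_lower
  rw [← rpow_one_third_cube P.w_pos.le] at h1
  have h2 := le_of_pow_le_pow_left₀ three_ne_zero P.root_pos.le h1
  rw [div_le_iff₀ h3] at h2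
  linarith

end Params

end Parameters

/-! ### Step sizes -/

section StepSizes

variable {n I J : ℕ} {Ξ Ω : Type*} [MeasurableSpace Ξ]
  {p : Problem n I J Ξ} {L G σ ω ρ μ κ w c : ℝ} {ξ : ℕ → Ω → Ξ} {x : ℕ → Ω → E n}

/-- The quantity `w + ∑_{i=1}^t ‖∇f(x_i, ξ_i)‖²` from which the step size is computed. -/
def accum (p : Problem n I J Ξ) (w : ℝ) (ξ : ℕ → Ω → Ξ) (x : ℕ → Ω → E n) (t : ℕ) (o : Ω) : ℝ :=
  w + ∑ i ∈ Finset.Icc 1 t, ‖p.gradf (x i o) (ξ i o)‖ ^ 2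

lemma stepSize_eq (t : ℕ) (o : Ω) :
    stepSize p κ w ξ x t o = κ / accum p w ξ x t o ^ (1 / 3 : ℝ) := rfl

lemma accum_succ (t : ℕ) (o : Ω) : accum p w ξ x (t + 1) o
    = accum p w ξ x t o + ‖p.gradf (x (t + 1) o) (ξ (t + 1) o)‖ ^ 2 := by
  unfold accum
  rw [Finset.sum_Icc_succ_top (by omega), add_assoc]

lemma accum_zero (o : Ω) : accum p w ξ x 0 o = w := by simp [accum]

lemma le_accum (t : ℕ) (o : Ω) : w ≤ accum p w ξ x t o :=
  le_add_of_nonneg_right (Finset.sum_nonneg fun _ _ => sq_nonneg _)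

section

variable (P : Params L G μ κ w c)
include P

lemma accum_pos (t : ℕ) (o : Ω) : 0 < accum p w ξ x t o := P.w_pos.trans_le (le_accum t o)

lemma root_le_accum_root (t : ℕ) (o : Ω) :
    w ^ (1 / 3 : ℝ) ≤ accum p w ξ x t o ^ (1 / 3 : ℝ) :=
  Real.rpow_le_rpow P.w_pos.le (le_accum t o) (by norm_num)

lemma accum_root_pos (t : ℕ) (o : Ω) : 0 < accum p w ξ x t o ^ (1 / 3 : ℝ) :=
  P.root_pos.trans_le (root_le_accum_root P t o)

lemma stepSize_pos (t : ℕ) (o : Ω) : 0 < stepSize p κ w ξ x t o :=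
  div_pos P.κ_pos (accum_root_pos P t o)

lemma stepSize_le (t : ℕ) (o : Ω) : stepSize p κ w ξ x t o ≤ κ / w ^ (1 / 3 : ℝ) :=
  div_le_div_of_nonneg_left P.κ_pos.le P.root_pos (root_le_accum_root P t o)

lemma stepSize_le_one (t : ℕ) (o : Ω) : stepSize p κ w ξ x t o ≤ 1 :=
  (stepSize_le P t o).trans ((div_le_one P.root_pos).2 P.κ_le)

lemma L_mul_stepSize_le (t : ℕ) (o : Ω) : L * stepSize p κ w ξ x t o ≤ 2 * μ - 3 / 2 := by
  refine (mul_le_mul_of_nonneg_left (stepSize_le P t o) P.L_pos.le).trans ?_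
  rw [← mul_div_assoc, div_le_iff₀ P.root_pos]
  exact P.L_mul_le

lemma c_mul_stepSize_sq_mem (t : ℕ) (o : Ω) :
    c * stepSize p κ w ξ x t o ^ 2 ∈ Icc (0 : ℝ) 1 := by
  have h1 := stepSize_pos (p := p) (ξ := ξ) (x := x) P t o
  have h2 := P.c_pos
  refine ⟨by positivity, ?_⟩
  have h3 : stepSize p κ w ξ x t o ^ 2 ≤ (κ / w ^ (1 / 3 : ℝ)) ^ 2 :=
    pow_le_pow_left₀ h1.le (stepSize_le P t o) 2
  refine (mul_le_mul_of_nonneg_left h3 h2.le).trans ?_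
  have h4 := P.root_pos
  rw [div_pow, ← mul_div_assoc, div_le_one (by positivity)]
  have h5 := P.c_mul_le
  have h6 := mul_nonneg h2.le (sq_nonneg κ)
  linarith

/-- The reciprocal step sizes increase slowly. -/
lemma inv_stepSize_succ_le (hp : p.Regular L G σ ω ρ) (t : ℕ) (o : Ω) :
    (stepSize p κ w ξ x (t + 1) o)⁻¹ ≤ (stepSize p κ w ξ x t o)⁻¹
      + G ^ 2 / (6 * L * κ ^ 3) * stepSize p κ w ξ x (t + 1) o := by
  rw [stepSize_eq, stepSize_eq]
  set a := accum p w ξ x t o ^ (1 / 3 : ℝ) with ha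
  set b := accum p w ξ x (t + 1) o ^ (1 / 3 : ℝ) with hb
  have hapos : 0 < a := accum_root_pos P t o
  have hbpos : 0 < b := accum_root_pos P (t + 1) o
  have hL := P.L_pos
  have hκ := P.κ_pos
  have h1 : b ^ 3 ≤ a ^ 3 + G ^ 2 := by
    rw [ha, hb, rpow_one_third_cube (accum_pos P _ _).le, rpow_one_third_cube (accum_pos P _ _).le,
      accum_succ]
    have := pow_le_pow_left₀ (norm_nonneg _)
      (hp.norm_gradf_le P.G_nonneg (x (t + 1) o) (ξ (t + 1) o)) 2
    linarith
  have hab : a ≤ b := by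
    refine Real.rpow_le_rpow (accum_pos P _ _).le ?_ (by norm_num)
    rw [accum_succ]
    exact le_add_of_nonneg_right (sq_nonneg _)
  have h2 : 4 * L * κ < a := P.four_mul_lt.trans_le (root_le_accum_root P t o)
  have h3 : (b - a) * (6 * L * κ * b) ≤ G ^ 2 := by
    have h4 : 6 * L * κ * b ≤ a ^ 2 + a * b + b ^ 2 := by nlinarith [sq_nonneg (a - b)]
    have h5 := mul_le_mul_of_nonneg_left h4 (sub_nonneg.2 hab)
    nlinarith
  have h6 : b - a ≤ G ^ 2 / (6 * L * κ * b) := by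
    rwa [le_div_iff₀ (by positivity)]
  rw [inv_div, inv_div]
  have h7 : G ^ 2 / (6 * L * κ ^ 3) * (κ / b) = (G ^ 2 / (6 * L * κ * b)) / κ := by
    field_simp
  rw [h7, ← add_div]
  gcongr
  linarith

/-- The logarithmic bound for the sum of normalized squared gradients. -/
lemma sum_stepSize_cube_le (hp : p.Regular L G σ ω ρ) (T : ℕ) (o : Ω) :
    ∑ t ∈ Finset.Icc 1 T, stepSize p κ w ξ x t o ^ 3 * ‖p.gradf (x (t + 1) o) (ξ (t + 1) o)‖ ^ 2
      ≤ 2 * κ ^ 3 * Real.log (T + 2) := by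
  have hG : ∀ t, ‖p.gradf (x t o) (ξ t o)‖ ^ 2 ≤ G ^ 2 := fun t =>
    pow_le_pow_left₀ (norm_nonneg _) (hp.norm_gradf_le P.G_nonneg _ _) 2
  have hκ := P.κ_pos
  have hstep : ∀ t, stepSize p κ w ξ x t o ^ 3 * ‖p.gradf (x (t + 1) o) (ξ (t + 1) o)‖ ^ 2
      ≤ 2 * κ ^ 3 * (Real.log (accum p w ξ x (t + 1) o) - Real.log (accum p w ξ x t o)) := by
    intro t
    have hA := accum_pos (p := p) (ξ := ξ) (x := x) P t o
    set g := ‖p.gradf (x (t + 1) o) (ξ (t + 1) o)‖ ^ 2 with hg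
    set A := accum p w ξ x t o with hAdef
    have hg0 : 0 ≤ g := sq_nonneg _
    have hgA : g ≤ A := (hG (t + 1)).trans (P.G_sq_le.trans (le_accum t o))
    have hB : 0 < A + g := by linarith
    rw [stepSize_eq, div_pow, rpow_one_third_cube hA.le, accum_succ, ← hg, ← hAdef,
      ← Real.log_div hB.ne' hA.ne']
    have h1 := Real.one_sub_inv_le_log_of_pos (div_pos hB hA)
    rw [inv_div] at h1
    have h2 : g / A ≤ 2 * (1 - A / (A + g)) := by
      rw [one_sub_div hB.ne', add_sub_cancel_left, ← mul_div_assoc, div_le_div_iff₀ hA hB]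
      nlinarith
    calc κ ^ 3 / A * g = κ ^ 3 * (g / A) := by ring
      _ ≤ κ ^ 3 * (2 * Real.log ((A + g) / A)) := by gcongr; linarith
      _ = _ := by ring
  have htel : ∀ T : ℕ, ∑ t ∈ Finset.Icc 1 T,
      stepSize p κ w ξ x t o ^ 3 * ‖p.gradf (x (t + 1) o) (ξ (t + 1) o)‖ ^ 2
      ≤ 2 * κ ^ 3 * (Real.log (accum p w ξ x (T + 1) o) - Real.log (accum p w ξ x 1 o)) := by
    intro T
    induction T with
    | zero => simp
    | succ T ih =>
      rw [Finset.sum_Icc_succ_top (by omega)]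
      have := hstep (T + 1)
      linarith
  refine (htel T).trans ?_
  have hw := P.w_pos
  have h1 : accum p w ξ x (T + 1) o ≤ w * (T + 2) := by
    unfold accum
    have h2 := Finset.sum_le_sum fun i (_ : i ∈ Finset.Icc 1 (T + 1)) => hG i
    rw [Finset.sum_const, Nat.card_Icc, nsmul_eq_mul] at h2
    have h3 := mul_le_mul_of_nonneg_left P.G_sq_le (Nat.cast_nonneg (α := ℝ) (T + 1))
    rw [Nat.add_sub_cancel] at h2
    have h4 : w * ((T : ℝ) + 2) = w + ((T + 1 : ℕ) : ℝ) * w := by push_cast; ring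
    rw [h4]
    linarith
  have h2 : Real.log (accum p w ξ x (T + 1) o) ≤ Real.log w + Real.log (T + 2) := by
    rw [← Real.log_mul hw.ne' (by positivity)]
    exact Real.log_le_log (accum_pos P _ _) h1
  have h3 : Real.log w ≤ Real.log (accum p w ξ x 1 o) := Real.log_le_log hw (le_accum 1 o)
  gcongr
  linarith

/-- Bounded gradients keep the step sizes above a multiple of `T ^ (-1/3)`. -/
lemma stepSize_ge (hp : p.Regular L G σ ω ρ) {t T : ℕ} (hT : 1 ≤ T) (ht : t ≤ T) (o : Ω) :
    κ / ((2 * w) ^ (1 / 3 : ℝ) * (T : ℝ) ^ (1 / 3 : ℝ)) ≤ stepSize p κ w ξ x t o := by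
  have hw := P.w_pos
  have hT' : (1 : ℝ) ≤ T := by exact_mod_cast hT
  rw [stepSize_eq, ← Real.mul_rpow (by positivity) (by positivity)]
  refine div_le_div_of_nonneg_left P.κ_pos.le (accum_root_pos P t o) ?_
  refine Real.rpow_le_rpow (accum_pos P _ _).le ?_ (by norm_num)
  unfold accum
  have h2 := Finset.sum_le_sum fun i (_ : i ∈ Finset.Icc 1 t) =>
    pow_le_pow_left₀ (norm_nonneg _) (hp.norm_gradf_le P.G_nonneg (x i o) (ξ i o)) 2
  rw [Finset.sum_const, Nat.card_Icc, nsmul_eq_mul, Nat.add_sub_cancel] at h2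
  have h3 : (t : ℝ) * G ^ 2 ≤ T * w := by
    have : (t : ℝ) ≤ T := by exact_mod_cast ht
    exact mul_le_mul this P.G_sq_le (sq_nonneg _) (by linarith)
  nlinarith

end

end StepSizes

/-! ### Pathwise analysis of a run -/

section Pathwise

variable {n I J : ℕ} {Ξ Ω : Type*} [MeasurableSpace Ξ]

/-- The assumptions on the problem, the surrogates and the run, without the assumptions on the
distribution of the samples. -/
structure Setting (p : Problem n I J Ξ) (q : Surrogates n J Ξ) (L G σ ω ρ μ κ w c B : ℝ) (x₁ : E n)
    (ξ : ℕ → Ω → Ξ) (x xhat z : ℕ → Ω → E n) : Prop where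
  params : Params L G μ κ w c
  regular : p.Regular L G σ ω ρ
  admissible : q.Admissible p L G μ
  start_mem : x₁ ∈ p.feasible
  run : IsRun p q κ w c x₁ ξ x xhat z
  bounded : SubObjectiveBounded p q κ w c B ξ x z

/-- The error `z_{t+1} - ∇U(x_t)` of the gradient estimate used in iteration `t ≥ 1`. -/
def gradError (p : Problem n I J Ξ) (x z : ℕ → Ω → E n) (t : ℕ) (o : Ω) : E n :=
  z (t + 1) o - ∇ p.U (x t o)

/-- The correction `(1 - β_t)(z_t - ∇f(x_{t-1}, ξ_t))` of the stochastic gradient in iteration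
`t ≥ 1`. -/
def correction (p : Problem n I J Ξ) (κ w c : ℝ) (ξ : ℕ → Ω → Ξ) (x z : ℕ → Ω → E n) (t : ℕ)
    (o : Ω) : E n :=
  (1 - momentum p κ w c ξ x t o) • (z t o - p.gradf (x (t - 1) o) (ξ t o))

variable {p : Problem n I J Ξ} {q : Surrogates n J Ξ} {L G σ ω ρ μ κ w c B : ℝ} {x₁ : E n}
  {ξ : ℕ → Ω → Ξ} {x xhat z : ℕ → Ω → E n}

lemma subObjective_eq (t : ℕ) (o : Ω) : subObjective p q κ w c ξ x z t o = fun y =>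
    subSmooth q (x t o) (correction p κ w c ξ x z t o) (ξ t o) y + p.u y := by
  funext y
  simp only [subObjective, subSmooth, correction, inner_smul_right]

namespace Setting

variable (S : Setting p q L G σ ω ρ μ κ w c B x₁ ξ x xhat z)
include S

lemma isMinOn {t : ℕ} (ht : 1 ≤ t) (o : Ω) :
    IsMinOn (fun y => subSmooth q (x t o) (correction p κ w c ξ x z t o) (ξ t o) y + p.u y)
      (p.subFeasible q (x t o)) (xhat t o) := by
  rw [← subObjective_eq]
  exact S.run.xhat_min t ht o

lemma z_succ_eq {t : ℕ} (ht : 1 ≤ t) (o : Ω) :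
    z (t + 1) o = p.gradf (x t o) (ξ t o) + correction p κ w c ξ x z t o :=
  S.run.z_succ t ht o

lemma x_succ_eq {t : ℕ} (ht : 1 ≤ t) (o : Ω) :
    x (t + 1) o = x t o + stepSize p κ w ξ x t o • (xhat t o - x t o) := by
  rw [S.run.x_succ t ht o]
  module

lemma x_succ_mem_subFeasible {t : ℕ} (ht : 1 ≤ t) (o : Ω) (hx : x t o ∈ p.feasible) :
    x (t + 1) o ∈ p.subFeasible q (x t o) := by
  rw [S.x_succ_eq ht]
  exact (S.admissible.subFeasible_convex S.regular hx).add_smul_sub_mem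
    (S.admissible.mem_subFeasible_self hx) (S.run.xhat_mem t ht o)
    ⟨(stepSize_pos S.params t o).le, stepSize_le_one S.params t o⟩

lemma x_mem (t : ℕ) (o : Ω) : x t o ∈ p.feasible := by
  have h1 : ∀ t, x (t + 1) o ∈ p.feasible := by
    intro t
    induction t with
    | zero => rw [zero_add, S.run.x_one]; exact S.start_mem
    | succ t ih =>
      exact S.admissible.subFeasible_subset _ ih (S.x_succ_mem_subFeasible (by omega) o ih)
  cases t with
  | zero => rw [S.run.x_zero]; exact S.start_mem
  | succ t => exact h1 t

lemma xhat_mem {t : ℕ} (ht : 1 ≤ t) (o : Ω) : xhat t o ∈ p.feasible :=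
  S.admissible.subFeasible_subset _ (S.x_mem t o) (S.run.xhat_mem t ht o)

lemma gap_le {t : ℕ} (ht : 1 ≤ t) (o : Ω) {y : E n} (hy : y ∈ p.feasible) :
    (subSmooth q (x t o) (correction p κ w c ξ x z t o) (ξ t o) y + p.u y)
      - (subSmooth q (x t o) (correction p κ w c ξ x z t o) (ξ t o) (xhat t o) + p.u (xhat t o))
      ≤ B := by
  have := S.bounded t ht o y hy _ (S.run.xhat_mem t ht o)
  rwa [subObjective_eq] at this

lemma step_sq_le {t : ℕ} (ht : 1 ≤ t) (o : Ω) : ‖xhat t o - x t o‖ ^ 2 ≤ 2 * B / μ := by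
  have h1 := S.admissible.norm_step_sq_le S.regular (S.x_mem t o) (S.run.xhat_mem t ht o)
    (S.isMinOn ht o)
  have h2 := h1.trans (S.gap_le ht o (S.x_mem t o))
  have hμ : 0 < μ := by linarith [S.params.μ_gt]
  rw [le_div_iff₀ hμ]
  linarith

/-- One step decreases the objective, up to the error of the gradient estimate. -/
lemma F_succ_le {t : ℕ} (ht : 1 ≤ t) (o : Ω) :
    p.F (x (t + 1) o) ≤ p.F (x t o)
      + stepSize p κ w ξ x t o / 2 * ‖gradError p x z t o‖ ^ 2
      - stepSize p κ w ξ x t o / 4 * ‖xhat t o - x t o‖ ^ 2 := by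
  have hη := stepSize_pos (p := p) (ξ := ξ) (x := x) S.params t o
  have hη1 := stepSize_le_one (p := p) (ξ := ξ) (x := x) S.params t o
  have hLη := L_mul_stepSize_le (p := p) (ξ := ξ) (x := x) S.params t o
  have h1 := S.admissible.inner_step_le S.regular (S.x_mem t o) (S.run.xhat_mem t ht o)
    (S.isMinOn ht o)
  rw [← S.z_succ_eq ht] at h1
  set η := stepSize p κ w ξ x t o with hηdef
  set Δ := xhat t o - x t o with hΔ
  have h2 := (S.regular.smoothOn_U S.params.G_nonneg).le_quadratic (a := x t o) (d := η • Δ)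
    fun _ _ => trivial
  rw [← S.x_succ_eq ht, norm_smul, inner_smul_right, Real.norm_of_nonneg hη.le, mul_pow] at h2
  have h3 := S.regular.u_convex.2 (S.regular.feasible_subset (S.xhat_mem ht o))
    (S.regular.feasible_subset (S.x_mem t o)) hη.le (by linarith : 0 ≤ 1 - η) (by ring)
  have e : η • xhat t o + (1 - η) • x t o = x (t + 1) o := by
    rw [S.run.x_succ t ht o, add_comm]
  rw [e, smul_eq_mul, smul_eq_mul] at h3
  have h4 : -(1 / 2 * ‖gradError p x z t o‖ ^ 2 + 1 / 2 * ‖Δ‖ ^ 2)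
      ≤ ⟪z (t + 1) o, Δ⟫ - ⟪∇ p.U (x t o), Δ⟫ := by
    rw [← inner_sub_left]
    change _ ≤ ⟪gradError p x z t o, Δ⟫
    have := neg_le_of_abs_le (abs_real_inner_le_norm (gradError p x z t o) Δ)
    nlinarith [sq_nonneg (‖gradError p x z t o‖ - ‖Δ‖)]
  unfold Problem.F
  have h5 := mul_le_mul_of_nonneg_left h1 hη.le
  have h6 := mul_le_mul_of_nonneg_left h4 hη.le
  have h7 := mul_le_mul_of_nonneg_right hLη (by positivity : 0 ≤ η / 2 * ‖Δ‖ ^ 2)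
  nlinarith

lemma norm_z_le (t : ℕ) (o : Ω) : ‖z (t + 1) o‖ ≤ (2 * t + 1) * G := by
  induction t with
  | zero =>
    rw [zero_add, S.run.z_one]
    simpa using S.regular.norm_gradf_le S.params.G_nonneg _ _
  | succ t ih =>
    rw [S.run.z_succ (t + 1) (by omega)]
    have hβ : momentum p κ w c ξ x (t + 1) o ∈ Icc (0 : ℝ) 1 :=
      c_mul_stepSize_sq_mem S.params t o
    have h1 := S.regular.norm_gradf_le S.params.G_nonneg (x (t + 1) o) (ξ (t + 1) o)
    have h2 := S.regular.norm_gradf_le S.params.G_nonneg (x (t + 1 - 1) o) (ξ (t + 1) o)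
    have h3 := norm_sub_le (z (t + 1) o) (p.gradf (x (t + 1 - 1) o) (ξ (t + 1) o))
    refine (norm_add_le _ _).trans ?_
    rw [norm_smul, Real.norm_of_nonneg (by linarith [hβ.2])]
    have h4 : (1 - momentum p κ w c ξ x (t + 1) o)
        * ‖z (t + 1) o - p.gradf (x (t + 1 - 1) o) (ξ (t + 1) o)‖
        ≤ ‖z (t + 1) o - p.gradf (x (t + 1 - 1) o) (ξ (t + 1) o)‖ :=
      mul_le_of_le_one_left (norm_nonneg _) (by linarith [hβ.1])
    have h5 : (2 * ((t + 1 : ℕ) : ℝ) + 1) * G = (2 * t + 1) * G + 2 * G := by push_cast; ring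
    rw [h5]
    linarith

lemma norm_gradError_le (t : ℕ) (o : Ω) : ‖gradError p x z t o‖ ≤ (2 * t + 2) * G := by
  refine (norm_sub_le _ _).trans ?_
  have h1 := S.norm_z_le t o
  have h2 := S.regular.norm_gradient_U_le S.params.G_nonneg (x t o)
  linarith

lemma exists_F_le (t : ℕ) : ∃ M, ∀ o, p.F (x (t + 1) o) ≤ M := by
  induction t with
  | zero => exact ⟨p.F x₁, fun o => by rw [zero_add, S.run.x_one]⟩
  | succ t ih =>
    obtain ⟨M, hM⟩ := ih
    refine ⟨M + 1 / 2 * ((2 * (t + 1 : ℕ) + 2) * G) ^ 2, fun o => ?_⟩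
    have h1 := S.F_succ_le (t := t + 1) (by omega) o
    have h2 := pow_le_pow_left₀ (norm_nonneg _) (S.norm_gradError_le (t + 1) o) 2
    have hη := stepSize_pos (p := p) (ξ := ξ) (x := x) S.params (t + 1) o
    have hη1 := stepSize_le_one (p := p) (ξ := ξ) (x := x) S.params (t + 1) o
    have h3 := mul_le_mul (div_le_div_of_nonneg_right hη1 two_pos.le) h2 (sq_nonneg _)
      (by norm_num)
    have h4 : 0 ≤ stepSize p κ w ξ x (t + 1) o / 4 * ‖xhat (t + 1) o - x (t + 1) o‖ ^ 2 := by
      positivity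
    linarith [hM o]

end Setting

end Pathwise

/-! ### Measurability with respect to the past samples -/

section Measurability

variable {n I J : ℕ} {Ξ Ω : Type*} [MeasurableSpace Ξ]

/-- The σ-algebra generated by the samples `ξ_1, …, ξ_t`. -/
abbrev past (ξ : ℕ → Ω → Ξ) (t : ℕ) : MeasurableSpace Ω :=
  ⨆ i ∈ Set.Icc 1 t, MeasurableSpace.comap (ξ i) inferInstance

lemma past_mono (ξ : ℕ → Ω → Ξ) {s t : ℕ} (h : s ≤ t) : past ξ s ≤ past ξ t :=
  biSup_mono fun _ hi => ⟨hi.1, hi.2.trans h⟩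

lemma measurable_sample (ξ : ℕ → Ω → Ξ) {i t : ℕ} (hi : 1 ≤ i) (ht : i ≤ t) :
    Measurable[past ξ t] (ξ i) :=
  measurable_iff_comap_le.2
    (le_iSup₂_of_le (f := fun i (_ : i ∈ Set.Icc 1 t) => MeasurableSpace.comap (ξ i) inferInstance)
      i ⟨hi, ht⟩ le_rfl)

variable {p : Problem n I J Ξ} {q : Surrogates n J Ξ} {L G σ ω ρ μ κ w c B : ℝ} {x₁ : E n}
  {ξ : ℕ → Ω → Ξ} {x xhat z : ℕ → Ω → E n}

lemma measurable_stepSize [MeasurableSpace Ω] (hp : p.Regular L G σ ω ρ) (hG : 0 ≤ G) {t : ℕ}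
    (hx : ∀ i, 1 ≤ i → i ≤ t → Measurable (x i)) (hξ : ∀ i, 1 ≤ i → i ≤ t → Measurable (ξ i)) :
    Measurable (stepSize p κ w ξ x t) := by
  unfold stepSize
  refine measurable_const.div (Measurable.pow_const (measurable_const.add ?_) _)
  refine Finset.measurable_sum _ fun i hi => ?_
  rw [Finset.mem_Icc] at hi
  exact (((hp.measurable_gradf hG).comp ((hx i hi.1 hi.2).prodMk (hξ i hi.1 hi.2))).norm).pow_const 2

namespace Setting

variable (S : Setting p q L G σ ω ρ μ κ w c B x₁ ξ x xhat z)
include S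

lemma measurable_x_past (t : ℕ) : Measurable[past ξ t] (x (t + 1)) := by
  induction t using Nat.strong_induction_on with
  | _ t ih =>
    cases t with
    | zero =>
      have : x (0 + 1) = fun _ => x₁ := funext S.run.x_one
      rw [this]
      exact measurable_const
    | succ t =>
      let _ := past ξ (t + 1)
      have hx : ∀ i, 1 ≤ i → i ≤ t + 1 → Measurable (x i) := by
        intro i hi hit
        obtain ⟨k, rfl⟩ : ∃ k, i = k + 1 := ⟨i - 1, by omega⟩
        exact (ih k (by omega)).mono (past_mono ξ (by omega)) le_rfl
      have hη : Measurable (stepSize p κ w ξ x (t + 1)) :=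
        measurable_stepSize S.regular S.params.G_nonneg hx fun i hi hit => measurable_sample ξ hi hit
      have hxh : Measurable (xhat (t + 1)) := S.run.xhat_measurable (t + 1) (by omega)
      have hx1 := hx (t + 1) (by omega) le_rfl
      have : x (t + 1 + 1) = fun o => x (t + 1) o
          + stepSize p κ w ξ x (t + 1) o • (xhat (t + 1) o - x (t + 1) o) :=
        funext fun o => S.x_succ_eq (by omega) o
      rw [this]
      exact hx1.add (hη.smul (hxh.sub hx1))

lemma measurable_x_of_le {s t : ℕ} (h : s ≤ t + 1) : Measurable[past ξ t] (x s) := by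
  cases s with
  | zero =>
    have : x 0 = fun _ => x₁ := funext S.run.x_zero
    rw [this]
    exact measurable_const
  | succ s => exact (S.measurable_x_past s).mono (past_mono ξ (by omega)) le_rfl

lemma measurable_stepSize_of_le {s t : ℕ} (h : s ≤ t) :
    Measurable[past ξ t] (stepSize p κ w ξ x s) := by
  let _ := past ξ t
  exact measurable_stepSize S.regular S.params.G_nonneg (fun i _ hi => S.measurable_x_of_le (by omega))
    fun i hi hi' => measurable_sample ξ hi (by omega)

lemma measurable_z_of_le {s t : ℕ} (h : s ≤ t) (hs : 1 ≤ s) : Measurable[past ξ t] (z s) := by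
  let _ := past ξ t
  induction s, hs using Nat.le_induction with
  | base =>
    have : z 1 = fun o => p.gradf (x 0 o) (ξ 1 o) := funext S.run.z_one
    rw [this]
    exact (S.regular.measurable_gradf S.params.G_nonneg).comp
      ((S.measurable_x_of_le (by omega)).prodMk (measurable_sample ξ le_rfl h))
  | succ s hs ih =>
    have hξ : Measurable (ξ s) := measurable_sample ξ hs (by omega)
    have hg : ∀ k, k ≤ t → Measurable fun o => p.gradf (x k o) (ξ s o) := fun k hk =>
      (S.regular.measurable_gradf S.params.G_nonneg).comp
        ((S.measurable_x_of_le (by omega)).prodMk hξ)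
    have hη : Measurable (stepSize p κ w ξ x (s - 1)) := S.measurable_stepSize_of_le (by omega)
    rw [show z (s + 1) = _ from funext fun o => S.run.z_succ s hs o]
    exact (hg s (by omega)).add ((measurable_const.sub ((hη.pow_const 2).const_mul c)).smul
      ((ih (by omega)).sub (hg (s - 1) (by omega))))

/-- `z_{t+1}` involves the samples up to `ξ_t` only. -/
lemma measurable_z_succ {t : ℕ} (ht : 1 ≤ t) : Measurable[past ξ t] (z (t + 1)) := by
  let _ := past ξ t
  have hξ : Measurable (ξ t) := measurable_sample ξ ht le_rfl
  have hg : ∀ k, k ≤ t → Measurable fun o => p.gradf (x k o) (ξ t o) := fun k hk =>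
    (S.regular.measurable_gradf S.params.G_nonneg).comp
      ((S.measurable_x_of_le (by omega)).prodMk hξ)
  have hη : Measurable (stepSize p κ w ξ x (t - 1)) := S.measurable_stepSize_of_le (by omega)
  have hz : Measurable (z t) := S.measurable_z_of_le le_rfl ht
  rw [show z (t + 1) = _ from funext fun o => S.run.z_succ t ht o]
  exact (hg t le_rfl).add ((measurable_const.sub ((hη.pow_const 2).const_mul c)).smul
    (hz.sub (hg (t - 1) (by omega))))

end Setting

end Measurability

/-! ### Independence and the variance of the gradient estimate -/

section Variance

variable {n I J : ℕ} {Ξ Ω : Type*} [MeasurableSpace Ξ] [MeasurableSpace Ω] {Pr : Measure Ω}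
  {p : Problem n I J Ξ} {L G σ ω ρ : ℝ} {ξ : ℕ → Ω → Ξ}

lemma IIDSamples.past_le (h : IIDSamples p Pr ξ) (t : ℕ) : past ξ t ≤ ‹MeasurableSpace Ω› :=
  iSup₂_le fun i hi => (h.measurable i hi.1).comap_le

lemma IIDSamples.indepFun_past (h : IIDSamples p Pr ξ) {α : Type*} [MeasurableSpace α] {Y : Ω → α}
    {t : ℕ} (hY : Measurable[past ξ t] Y) : IndepFun Y (ξ (t + 1)) Pr := by
  have h1 := indep_iSup_of_disjoint (m := fun k => MeasurableSpace.comap (ξ (k + 1)) inferInstance)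
    (fun k => (h.measurable (k + 1) (by omega)).comap_le) h.indep
    (S := Set.Iio t) (T := {t}) (by simp)
  rw [IndepFun_iff_Indep]
  refine indep_of_indep_of_le_left (indep_of_indep_of_le_right h1 ?_) ?_
  · simp
  · refine hY.comap_le.trans ?_
    refine iSup₂_le fun i hi => ?_
    obtain ⟨k, rfl⟩ : ∃ k, i = k + 1 := ⟨i - 1, by have := hi.1; omega⟩
    exact le_iSup₂_of_le (f := fun k (_ : k ∈ Set.Iio t) =>
      MeasurableSpace.comap (ξ (k + 1)) inferInstance) k (by have := hi.2; simp; omega) le_rfl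

/-- Expectations of functions of two independent variables can be compared by freezing the first
variable. -/
lemma integral_le_of_indepFun {α : Type*} [MeasurableSpace α] [IsProbabilityMeasure Pr]
    {Y : Ω → α} {X : Ω → Ξ} (hY : Measurable Y) (hX : Measurable X) (hYX : IndepFun Y X Pr)
    {f g : α → Ξ → ℝ} (hf : Measurable (Function.uncurry f)) (hg : Measurable (Function.uncurry g))
    (hfi : Integrable (fun o => f (Y o) (X o)) Pr) (hgi : Integrable (fun o => g (Y o) (X o)) Pr)
    (hle : ∀ o, ∫ s, f (Y o) s ∂(Pr.map X) ≤ ∫ s, g (Y o) s ∂(Pr.map X)) :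
    ∫ o, f (Y o) (X o) ∂Pr ≤ ∫ o, g (Y o) (X o) ∂Pr := by
  have := Measure.isProbabilityMeasure_map (μ := Pr) hX.aemeasurable
  have := Measure.isProbabilityMeasure_map (μ := Pr) hY.aemeasurable
  have hmap := (indepFun_iff_map_prod_eq_prod_map_map hY.aemeasurable hX.aemeasurable).1 hYX
  have key : ∀ {f : α → Ξ → ℝ}, Measurable (Function.uncurry f) →
      Integrable (fun o => f (Y o) (X o)) Pr →
      Integrable (fun o => ∫ s, f (Y o) s ∂(Pr.map X)) Pr ∧
      ∫ o, f (Y o) (X o) ∂Pr = ∫ o, ∫ s, f (Y o) s ∂(Pr.map X) ∂Pr := by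
    intro f hf hfi
    have h1 : Integrable (Function.uncurry f) ((Pr.map Y).prod (Pr.map X)) := by
      rw [← hmap, integrable_map_measure hf.aestronglyMeasurable (hY.prodMk hX).aemeasurable]
      exact hfi
    have h2 : StronglyMeasurable fun y => ∫ s, f y s ∂(Pr.map X) :=
      StronglyMeasurable.integral_prod_right hf.stronglyMeasurable
    refine ⟨?_, ?_⟩
    · have h3 : Integrable (fun y => ∫ s, f y s ∂(Pr.map X)) (Pr.map Y) := h1.integral_prod_left
      rw [integrable_map_measure h2.aestronglyMeasurable hY.aemeasurable] at h3
      exact h3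
    · calc ∫ o, f (Y o) (X o) ∂Pr
          = ∫ a, Function.uncurry f a ∂(Pr.map fun o => (Y o, X o)) :=
            (integral_map (hY.prodMk hX).aemeasurable hf.aestronglyMeasurable).symm
        _ = ∫ y, ∫ s, f y s ∂(Pr.map X) ∂(Pr.map Y) := by
            rw [hmap, integral_prod _ h1]; rfl
        _ = _ := integral_map hY.aemeasurable h2.aestronglyMeasurable
  rw [(key hf hfi).2, (key hg hgi).2]
  exact integral_mono (key hf hfi).1 (key hg hgi).1 hle

/-- A centered perturbation of a constant vector increases the mean square norm by at most the
second moment. -/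
lemma integral_norm_add_centered_sq_le {P : Measure Ξ} [IsProbabilityMeasure P] {W : Ξ → E n}
    (hW : Integrable W P) (hW2 : Integrable (fun s => ‖W s‖ ^ 2) P) (a : E n) :
    ∫ s, ‖a + (W s - ∫ s, W s ∂P)‖ ^ 2 ∂P ≤ ‖a‖ ^ 2 + ∫ s, ‖W s‖ ^ 2 ∂P := by
  set m := ∫ s, W s ∂P with hm
  have e : ∀ s, ‖a + (W s - m)‖ ^ 2 = ‖a - m‖ ^ 2 + 2 * ⟪a - m, W s⟫ + ‖W s‖ ^ 2 := fun s => by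
    rw [← norm_add_sq_real]; congr 2; abel
  simp_rw [e]
  have hi1 : Integrable (fun _ : Ξ => ‖a - m‖ ^ 2) P := integrable_const _
  have hi2 : Integrable (fun s => 2 * ⟪a - m, W s⟫) P := (hW.const_inner _).const_mul 2
  have hi3 : Integrable (fun s => ‖a - m‖ ^ 2 + 2 * ⟪a - m, W s⟫) P := hi1.add hi2
  rw [integral_add hi3 hW2, integral_add hi1 hi2, integral_const_mul, integral_inner hW, ← hm]
  simp only [integral_const, probReal_univ, one_smul]
  have h1 := norm_sub_sq_real a m
  rw [inner_sub_left, real_inner_self_eq_norm_sq]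
  nlinarith [sq_nonneg ‖m‖]

/-- The conditional mean square error of the recursive momentum estimate, for frozen past. -/
lemma Problem.Regular.integral_norm_estimate_sq_le (hp : p.Regular L G σ ω ρ) (hG : 0 ≤ G)
    (x x' v : E n) {b : ℝ} (hb : b ∈ Icc (0 : ℝ) 1) :
    ∫ s, ‖p.gradf x' s + (1 - b) • (v - p.gradf x s) - ∇ p.U x'‖ ^ 2 ∂p.law
      ≤ (1 - b) * ‖v - ∇ p.U x‖ ^ 2 + 2 * L ^ 2 * ‖x' - x‖ ^ 2
        + 2 * b ^ 2 * ∫ s, ‖p.gradf x' s‖ ^ 2 ∂p.law := by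
  have := hp.law_prob
  have hsq : ∀ {W : Ξ → E n} {M : ℝ}, Integrable W p.law → (∀ s, ‖W s‖ ≤ M) →
      Integrable (fun s => ‖W s‖ ^ 2) p.law := fun hW hM =>
    Integrable.of_bound (hW.aestronglyMeasurable.norm.pow 2) (_ ^ 2)
      (Filter.Eventually.of_forall fun s => by
        rw [Real.norm_of_nonneg (sq_nonneg _)]
        exact pow_le_pow_left₀ (norm_nonneg _) (hM s) 2)
  set W : Ξ → E n := fun s => p.gradf x' s - (1 - b) • p.gradf x s with hWdef
  have hi := hp.integrable_gradf hG
  have hW : Integrable W p.law := (hi x').sub ((hi x).smul (1 - b))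
  have hWb : ∀ s, ‖W s‖ ≤ G + (1 - b) * G := fun s => by
    refine (norm_sub_le _ _).trans ?_
    rw [norm_smul, Real.norm_of_nonneg (by linarith [hb.2])]
    exact add_le_add (hp.norm_gradf_le hG _ _)
      (mul_le_mul_of_nonneg_left (hp.norm_gradf_le hG _ _) (by linarith [hb.2]))
  have hmean : ∫ s, W s ∂p.law = ∇ p.U x' - (1 - b) • ∇ p.U x := by
    have hi' : Integrable (fun s => (1 - b) • p.gradf x s) p.law := (hi x).smul (1 - b)
    simp only [hWdef]
    rw [integral_sub (hi x') hi', integral_smul, hp.gradient_U hG, hp.gradient_U hG]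
  have e : ∀ s, p.gradf x' s + (1 - b) • (v - p.gradf x s) - ∇ p.U x'
      = (1 - b) • (v - ∇ p.U x) + (W s - ∫ s, W s ∂p.law) := fun s => by
    rw [hmean, hWdef]; module
  simp_rw [e]
  refine (integral_norm_add_centered_sq_le hW (hsq hW hWb) _).trans ?_
  have h1 : ‖(1 - b) • (v - ∇ p.U x)‖ ^ 2 ≤ (1 - b) * ‖v - ∇ p.U x‖ ^ 2 := by
    rw [norm_smul, mul_pow, Real.norm_of_nonneg (by linarith [hb.2])]
    refine mul_le_mul_of_nonneg_right ?_ (sq_nonneg _)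
    nlinarith [hb.1, hb.2]
  have h2 : ∫ s, ‖W s‖ ^ 2 ∂p.law
      ≤ ∫ s, (2 * L ^ 2 * ‖x' - x‖ ^ 2 + 2 * b ^ 2 * ‖p.gradf x' s‖ ^ 2) ∂p.law := by
    refine integral_mono (hsq hW hWb) ((integrable_const _).add
      ((hsq (hi x') (hp.norm_gradf_le hG x')).const_mul _)) fun s => ?_
    have e2 : W s = (1 - b) • (p.gradf x' s - p.gradf x s) + b • p.gradf x' s := by
      rw [hWdef]; module
    have h3 : ‖W s‖ ≤ L * ‖x' - x‖ + b * ‖p.gradf x' s‖ := by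
      rw [e2]
      refine (norm_add_le _ _).trans ?_
      rw [norm_smul, norm_smul, Real.norm_of_nonneg hb.1, Real.norm_of_nonneg (by linarith [hb.2])]
      refine add_le_add_left ?_ _
      refine (mul_le_of_le_one_left (norm_nonneg _) (by linarith [hb.1])).trans ?_
      exact hp.norm_gradf_sub_le x' x s
    have h4 := pow_le_pow_left₀ (norm_nonneg _) h3 2
    simp only
    nlinarith [sq_nonneg (L * ‖x' - x‖ - b * ‖p.gradf x' s‖)]
  rw [integral_add (integrable_const _) ((hsq (hi x') (hp.norm_gradf_le hG x')).const_mul _),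
    integral_const, probReal_univ, one_smul, integral_const_mul] at h2
  linarith

end Variance

/-! ### The potential and its expected decrease -/

section BoundedFunctions

variable {Ω : Type*} [MeasurableSpace Ω] {f g : Ω → ℝ}

/-- Bounded measurable functions, an algebra of integrable functions. -/
def BoundedMeasurable (f : Ω → ℝ) : Prop :=
  Measurable f ∧ ∃ M, ∀ o, |f o| ≤ M

namespace BoundedMeasurable

lemma const (a : ℝ) : BoundedMeasurable fun _ : Ω => a :=
  ⟨measurable_const, |a|, fun _ => le_rfl⟩

lemma add (hf : BoundedMeasurable f) (hg : BoundedMeasurable g) :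
    BoundedMeasurable fun o => f o + g o := by
  obtain ⟨hf, M, hM⟩ := hf
  obtain ⟨hg, N, hN⟩ := hg
  exact ⟨hf.add hg, M + N, fun o => (abs_add_le _ _).trans (add_le_add (hM o) (hN o))⟩

lemma mul (hf : BoundedMeasurable f) (hg : BoundedMeasurable g) :
    BoundedMeasurable fun o => f o * g o := by
  obtain ⟨hf, M, hM⟩ := hf
  obtain ⟨hg, N, hN⟩ := hg
  refine ⟨hf.mul hg, M * N, fun o => ?_⟩
  rw [abs_mul]
  exact mul_le_mul (hM o) (hN o) (abs_nonneg _) ((abs_nonneg _).trans (hM o))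

lemma const_mul (a : ℝ) (hf : BoundedMeasurable f) : BoundedMeasurable fun o => a * f o :=
  (const a).mul hf

lemma sub (hf : BoundedMeasurable f) (hg : BoundedMeasurable g) :
    BoundedMeasurable fun o => f o - g o := by
  simpa [sub_eq_add_neg] using hf.add (hg.const_mul (-1))

lemma pow (hf : BoundedMeasurable f) (k : ℕ) : BoundedMeasurable fun o => f o ^ k := by
  obtain ⟨hf, M, hM⟩ := hf
  refine ⟨hf.pow_const k, M ^ k, fun o => ?_⟩
  rw [abs_pow]
  exact pow_le_pow_left₀ (abs_nonneg _) (hM o) k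

lemma norm {n : ℕ} {v : Ω → E n} (hv : Measurable v) {M : ℝ} (hM : ∀ o, ‖v o‖ ≤ M) :
    BoundedMeasurable fun o => ‖v o‖ :=
  ⟨hv.norm, M, fun o => by rw [abs_norm]; exact hM o⟩

lemma integrable {Pr : Measure Ω} [IsFiniteMeasure Pr] (hf : BoundedMeasurable f) :
    Integrable f Pr := by
  obtain ⟨hf, M, hM⟩ := hf
  exact Integrable.of_bound hf.aestronglyMeasurable M (Filter.Eventually.of_forall hM)

end BoundedMeasurable

end BoundedFunctions

section Potential

variable {n I J : ℕ} {Ξ Ω : Type*} [MeasurableSpace Ξ] [MeasurableSpace Ω]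
  {p : Problem n I J Ξ} {q : Surrogates n J Ξ} {L G σ ω ρ μ κ w c B : ℝ} {x₁ : E n}
  {ξ : ℕ → Ω → Ξ} {x xhat z : ℕ → Ω → E n} {Pr : Measure Ω}

namespace Setting

variable (S : Setting p q L G σ ω ρ μ κ w c B x₁ ξ x xhat z) (hξ : IIDSamples p Pr ξ)
include S hξ

lemma measurable_x (t : ℕ) : Measurable (x t) :=
  (S.measurable_x_of_le (Nat.le_succ t)).mono (hξ.past_le t) le_rfl

lemma measurable_xhat {t : ℕ} (ht : 1 ≤ t) : Measurable (xhat t) :=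
  (S.run.xhat_measurable t ht).mono (hξ.past_le t) le_rfl

lemma measurable_z {t : ℕ} (ht : 1 ≤ t) : Measurable (z t) :=
  (S.measurable_z_of_le le_rfl ht).mono (hξ.past_le t) le_rfl

lemma measurable_step (t : ℕ) : Measurable (stepSize p κ w ξ x t) :=
  (S.measurable_stepSize_of_le le_rfl).mono (hξ.past_le t) le_rfl

lemma measurable_gradError (t : ℕ) : Measurable (gradError p x z t) :=
  (S.measurable_z hξ (by omega)).sub
    (((S.regular.smoothOn_U S.params.G_nonneg).continuous_gradient S.params.L_pos.le).measurable.comp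
      (S.measurable_x hξ t))

omit hξ in
lemma measurable_u_comp {y : Ω → E n} (hy : Measurable y) (hmem : ∀ o, y o ∈ p.dom) :
    Measurable fun o => p.u (y o) := by
  have h : (fun o => p.u (y o)) = p.dom.indicator p.u ∘ y :=
    funext fun o => (indicator_of_mem (hmem o) p.u).symm
  rw [h]
  exact S.regular.u_measurable.comp hy

lemma boundedMeasurable_step (t : ℕ) : BoundedMeasurable (stepSize p κ w ξ x t) :=
  ⟨S.measurable_step hξ t, 1, fun o => by
    rw [abs_of_pos (stepSize_pos S.params t o)]; exact stepSize_le_one S.params t o⟩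

lemma boundedMeasurable_inv_step (t : ℕ) :
    BoundedMeasurable fun o => (stepSize p κ w ξ x t o)⁻¹ := by
  refine ⟨(S.measurable_step hξ t).inv,
    (κ / ((2 * w) ^ (1 / 3 : ℝ) * ((t + 1 : ℕ) : ℝ) ^ (1 / 3 : ℝ)))⁻¹, fun o => ?_⟩
  have hη := stepSize_pos (p := p) (ξ := ξ) (x := x) S.params t o
  have h1 := stepSize_ge S.params S.regular (ξ := ξ) (x := x) (T := t + 1) (by omega)
    (Nat.le_succ t) o
  have hw := S.params.w_pos
  have hκ := S.params.κ_pos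
  rw [abs_of_pos (inv_pos.2 hη)]
  exact inv_anti₀ (by positivity) h1

lemma boundedMeasurable_gradError (t : ℕ) : BoundedMeasurable fun o => ‖gradError p x z t o‖ :=
  BoundedMeasurable.norm (S.measurable_gradError hξ t) (S.norm_gradError_le t)

lemma boundedMeasurable_delta {t : ℕ} (ht : 1 ≤ t) :
    BoundedMeasurable fun o => ‖xhat t o - x t o‖ :=
  BoundedMeasurable.norm ((S.measurable_xhat hξ ht).sub (S.measurable_x hξ t))
    fun o => Real.le_sqrt_of_sq_le (S.step_sq_le ht o)

lemma boundedMeasurable_gradf {t : ℕ} (ht : 1 ≤ t) :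
    BoundedMeasurable fun o => ‖p.gradf (x t o) (ξ t o)‖ :=
  BoundedMeasurable.norm ((S.regular.measurable_gradf S.params.G_nonneg).comp
    ((S.measurable_x hξ t).prodMk (hξ.measurable t ht)))
    fun _ => S.regular.norm_gradf_le S.params.G_nonneg _ _

lemma boundedMeasurable_F {Fstar : ℝ} (hF : ∀ y ∈ p.feasible, Fstar ≤ p.F y) {t : ℕ} (ht : 1 ≤ t) :
    BoundedMeasurable fun o => p.F (x t o) := by
  obtain ⟨s, rfl⟩ : ∃ s, t = s + 1 := ⟨t - 1, by omega⟩
  obtain ⟨M, hM⟩ := S.exists_F_le s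
  have hx := S.measurable_x hξ (s + 1)
  have hU : Continuous p.U := continuous_iff_continuousAt.2 fun y =>
    (S.regular.hasGradientAt_U S.params.G_nonneg y).differentiableAt.continuousAt
  refine ⟨(hU.measurable.comp hx).add (S.measurable_u_comp hx fun o =>
    S.regular.feasible_subset (S.x_mem _ o)), max |Fstar| |M|, fun o => ?_⟩
  exact abs_le_max_abs_abs (hF _ (S.x_mem _ o)) (hM o)

variable [IsProbabilityMeasure Pr]

/-- The expected error of the gradient estimate, weighted by the reciprocal of the step size, over
one iteration. -/
lemma integral_gradError_succ_le {t : ℕ} (ht : 1 ≤ t) :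
    ∫ o, ‖gradError p x z (t + 1) o‖ ^ 2 * (stepSize p κ w ξ x t o)⁻¹ ∂Pr
      ≤ ∫ o, ((1 - c * stepSize p κ w ξ x t o ^ 2) * ‖gradError p x z t o‖ ^ 2
          + 2 * L ^ 2 * ‖x (t + 1) o - x t o‖ ^ 2
          + 2 * (c * stepSize p κ w ξ x t o ^ 2) ^ 2
            * ‖p.gradf (x (t + 1) o) (ξ (t + 1) o)‖ ^ 2) * (stepSize p κ w ξ x t o)⁻¹ ∂Pr := by
  have hG := S.params.G_nonneg
  set Y : Ω → (E n × E n) × (E n × ℝ) := fun o =>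
    ((x t o, x (t + 1) o), (z (t + 1) o, stepSize p κ w ξ x t o)) with hY
  have hYp : Measurable[past ξ t] Y := by
    let _ := past ξ t
    exact ((S.measurable_x_of_le (by omega)).prodMk (S.measurable_x_of_le le_rfl)).prodMk
      ((S.measurable_z_succ ht).prodMk (S.measurable_stepSize_of_le le_rfl))
  have hYm : Measurable Y := hYp.mono (hξ.past_le t) le_rfl
  have hgU : Measurable (∇ p.U) :=
    ((S.regular.smoothOn_U hG).continuous_gradient S.params.L_pos.le).measurable
  have hgf := S.regular.measurable_gradf hG
  have hg2 : Measurable fun a : ((E n × E n) × (E n × ℝ)) × Ξ => p.gradf a.1.1.2 a.2 :=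
    hgf.comp (f := fun a : ((E n × E n) × (E n × ℝ)) × Ξ => (a.1.1.2, a.2)) (by fun_prop)
  have hg1 : Measurable fun a : ((E n × E n) × (E n × ℝ)) × Ξ => p.gradf a.1.1.1 a.2 :=
    hgf.comp (f := fun a : ((E n × E n) × (E n × ℝ)) × Ξ => (a.1.1.1, a.2)) (by fun_prop)
  have hU2 : Measurable fun a : ((E n × E n) × (E n × ℝ)) × Ξ => ∇ p.U a.1.1.2 :=
    hgU.comp (by fun_prop)
  have hU1 : Measurable fun a : ((E n × E n) × (E n × ℝ)) × Ξ => ∇ p.U a.1.1.1 :=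
    hgU.comp (by fun_prop)
  set f : (E n × E n) × (E n × ℝ) → Ξ → ℝ := fun y s =>
    ‖p.gradf y.1.2 s + (1 - c * y.2.2 ^ 2) • (y.2.1 - p.gradf y.1.1 s) - ∇ p.U y.1.2‖ ^ 2
      * y.2.2⁻¹ with hf
  set g : (E n × E n) × (E n × ℝ) → Ξ → ℝ := fun y s =>
    ((1 - c * y.2.2 ^ 2) * ‖y.2.1 - ∇ p.U y.1.1‖ ^ 2 + 2 * L ^ 2 * ‖y.1.2 - y.1.1‖ ^ 2
      + 2 * (c * y.2.2 ^ 2) ^ 2 * ‖p.gradf y.1.2 s‖ ^ 2) * y.2.2⁻¹ with hg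
  have hfm : Measurable (Function.uncurry f) := by
    simp only [hf, Function.uncurry_def]
    fun_prop
  have hgm : Measurable (Function.uncurry g) := by
    simp only [hg, Function.uncurry_def]
    fun_prop
  have hfeq : ∀ o, ‖gradError p x z (t + 1) o‖ ^ 2 * (stepSize p κ w ξ x t o)⁻¹
      = f (Y o) (ξ (t + 1) o) := fun o => by
    simp only [hf, hY, gradError, S.run.z_succ (t + 1) (by omega) o, momentum, Nat.add_sub_cancel]
  have hinv := S.boundedMeasurable_inv_step hξ t
  have hb := (((S.boundedMeasurable_step hξ t).pow 2).const_mul c)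
  have hΔ : BoundedMeasurable fun o => ‖x (t + 1) o - x t o‖ := by
    have : (fun o => ‖x (t + 1) o - x t o‖)
        = fun o => stepSize p κ w ξ x t o * ‖xhat t o - x t o‖ := funext fun o => by
      rw [S.x_succ_eq ht, add_sub_cancel_left, norm_smul,
        Real.norm_of_nonneg (stepSize_pos S.params t o).le]
    rw [this]
    exact (S.boundedMeasurable_step hξ t).mul (S.boundedMeasurable_delta hξ ht)
  have hgint : Integrable (fun o => g (Y o) (ξ (t + 1) o)) Pr :=
    BoundedMeasurable.integrable <|
      ((((((BoundedMeasurable.const 1).sub hb).mul ((S.boundedMeasurable_gradError hξ t).pow 2)).add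
        ((hΔ.pow 2).const_mul (2 * L ^ 2))).add
        (((hb.pow 2).const_mul 2).mul ((S.boundedMeasurable_gradf hξ (by omega)).pow 2))).mul hinv)
  have hfint : Integrable (fun o => f (Y o) (ξ (t + 1) o)) Pr := by
    simp_rw [← hfeq]
    exact (((S.boundedMeasurable_gradError hξ (t + 1)).pow 2).mul hinv).integrable
  simp_rw [hfeq]
  refine integral_le_of_indepFun hYm (hξ.measurable (t + 1) (by omega)) (hξ.indepFun_past hYp)
    hfm hgm hfint hgint fun o => ?_
  rw [hξ.law_eq (t + 1) (by omega)]
  have hp := S.regular.law_prob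
  simp only [hf, hg, hY]
  rw [integral_mul_const, integral_mul_const]
  refine mul_le_mul_of_nonneg_right ?_ (inv_nonneg.2 (stepSize_pos S.params t o).le)
  have hgi : Integrable (fun s => ‖p.gradf (x (t + 1) o) s‖ ^ 2) p.law :=
    BoundedMeasurable.integrable ((BoundedMeasurable.norm (hgf.comp measurable_prodMk_left)
      (S.regular.norm_gradf_le hG (x (t + 1) o))).pow 2)
  rw [integral_add (integrable_const _) (hgi.const_mul _), integral_const, probReal_univ, one_smul,
    integral_const_mul]
  exact S.regular.integral_norm_estimate_sq_le hG (x t o) (x (t + 1) o) (z (t + 1) o)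
    (c_mul_stepSize_sq_mem S.params t o)

end Setting

/-- The margin in the lower bound on `c`. -/
def margin (L G κ c : ℝ) : ℝ := c - 4 * L ^ 2 - G ^ 2 / (6 * L * κ ^ 3)

/-- The weight of the gradient error in the potential `F(x_t) + a ‖e_t‖² / η_{t-1}`. It lies
slightly below `1 / (8L²)`, so that both quadratic terms of the descent inequality keep a negative
coefficient. -/
def errorWeight (L G κ c : ℝ) : ℝ := 1 / (8 * L ^ 2 + margin L G κ c)

/-- The rate of decrease of the potential. -/
def decreaseRate (L G κ c : ℝ) : ℝ := margin L G κ c / (4 * (8 * L ^ 2 + margin L G κ c))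

section

variable (P : Params L G μ κ w c)
include P

lemma Params.margin_pos : 0 < margin L G κ c := by
  have := P.c_lower
  unfold margin
  linarith

lemma Params.errorWeight_pos : 0 < errorWeight L G κ c := by
  have h1 := P.margin_pos
  have h2 := P.L_pos
  unfold errorWeight
  positivity

lemma Params.decreaseRate_pos : 0 < decreaseRate L G κ c := by
  have h1 := P.margin_pos
  have h2 := P.L_pos
  unfold decreaseRate
  positivity

end

namespace Setting

variable (S : Setting p q L G σ ω ρ μ κ w c B x₁ ξ x xhat z)

include S in
omit [MeasurableSpace Ω] in
/-- The pathwise inequality behind the decrease of the potential: the bound for the next potential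
that is available before the next sample is drawn, compared with the present potential. -/
lemma potential_le {t : ℕ} (ht : 1 ≤ t) (o : Ω) (g : ℝ) :
    p.F (x (t + 1) o) + errorWeight L G κ c
        * (((1 - c * stepSize p κ w ξ x t o ^ 2) * ‖gradError p x z t o‖ ^ 2
          + 2 * L ^ 2 * ‖x (t + 1) o - x t o‖ ^ 2
          + 2 * (c * stepSize p κ w ξ x t o ^ 2) ^ 2 * g) * (stepSize p κ w ξ x t o)⁻¹)
      ≤ p.F (x t o)
        + errorWeight L G κ c * (‖gradError p x z t o‖ ^ 2 * (stepSize p κ w ξ x (t - 1) o)⁻¹)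
        - decreaseRate L G κ c * (stepSize p κ w ξ x t o
          * (‖xhat t o - x t o‖ ^ 2 + ‖gradError p x z t o‖ ^ 2))
        + 2 * errorWeight L G κ c * c ^ 2 * (stepSize p κ w ξ x t o ^ 3 * g) := by
  have h1 := S.F_succ_le ht o
  have hη := stepSize_pos (p := p) (ξ := ξ) (x := x) S.params t o
  have h2 := inv_stepSize_succ_le (ξ := ξ) (x := x) S.params S.regular (t - 1) o
  rw [Nat.sub_add_cancel ht] at h2
  have hΔ : ‖x (t + 1) o - x t o‖ ^ 2
      = stepSize p κ w ξ x t o ^ 2 * ‖xhat t o - x t o‖ ^ 2 := by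
    rw [S.x_succ_eq ht, add_sub_cancel_left, norm_smul, Real.norm_of_nonneg hη.le, mul_pow]
  rw [hΔ]
  set η := stepSize p κ w ξ x t o
  set i := (stepSize p κ w ξ x (t - 1) o)⁻¹
  set e := ‖gradError p x z t o‖ ^ 2 with he
  set D := ‖xhat t o - x t o‖ ^ 2 with hD
  have he0 : 0 ≤ e := sq_nonneg _
  have hδ := S.params.margin_pos
  have hL := S.params.L_pos
  have hden : 0 < 8 * L ^ 2 + margin L G κ c := by positivity
  have ha := S.params.errorWeight_pos
  have hexp : ((1 - c * η ^ 2) * e + 2 * L ^ 2 * (η ^ 2 * D) + 2 * (c * η ^ 2) ^ 2 * g) * η⁻¹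
      = (η⁻¹ - c * η) * e + 2 * L ^ 2 * η * D + 2 * c ^ 2 * (η ^ 3 * g) := by
    field_simp
  have h3 : η⁻¹ - c * η ≤ i - (4 * L ^ 2 + margin L G κ c) * η := by
    unfold margin
    linarith
  have h4 := mul_le_mul_of_nonneg_left (mul_le_mul_of_nonneg_right h3 he0) ha.le
  -- the two identities that the choice of the weight is made for
  have hw1 : errorWeight L G κ c * (4 * L ^ 2 + margin L G κ c)
      = 1 / 2 + 2 * decreaseRate L G κ c := by
    unfold errorWeight decreaseRate
    field_simp
    ring
  have hw2 : errorWeight L G κ c * (2 * L ^ 2) = 1 / 4 - decreaseRate L G κ c := by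
    unfold errorWeight decreaseRate
    field_simp
    ring
  have hθ := S.params.decreaseRate_pos
  have h5 : 0 ≤ decreaseRate L G κ c * (η * e) := by positivity
  rw [hexp]
  have h6 : errorWeight L G κ c * ((η⁻¹ - c * η) * e + 2 * L ^ 2 * η * D + 2 * c ^ 2 * (η ^ 3 * g))
      ≤ errorWeight L G κ c * (e * i) - (1 / 2 + 2 * decreaseRate L G κ c) * (η * e)
        + (1 / 4 - decreaseRate L G κ c) * (η * D)
        + 2 * errorWeight L G κ c * c ^ 2 * (η ^ 3 * g) := by
    rw [← hw1, ← hw2]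
    linarith
  linarith

variable (hξ : IIDSamples p Pr ξ) {Fstar : ℝ} (hF : ∀ y ∈ p.feasible, Fstar ≤ p.F y)
  [IsProbabilityMeasure Pr]
include S hξ hF

lemma integral_potential_succ_le {t : ℕ} (ht : 1 ≤ t) :
    (∫ o, p.F (x (t + 1) o) ∂Pr) + errorWeight L G κ c
        * ∫ o, ‖gradError p x z (t + 1) o‖ ^ 2 * (stepSize p κ w ξ x t o)⁻¹ ∂Pr
      ≤ (∫ o, p.F (x t o) ∂Pr) + errorWeight L G κ c
          * (∫ o, ‖gradError p x z t o‖ ^ 2 * (stepSize p κ w ξ x (t - 1) o)⁻¹ ∂Pr)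
        - decreaseRate L G κ c * (∫ o, stepSize p κ w ξ x t o
          * (‖xhat t o - x t o‖ ^ 2 + ‖gradError p x z t o‖ ^ 2) ∂Pr)
        + 2 * errorWeight L G κ c * c ^ 2 * ∫ o, stepSize p κ w ξ x t o ^ 3
            * ‖p.gradf (x (t + 1) o) (ξ (t + 1) o)‖ ^ 2 ∂Pr := by
  have h1 := mul_le_mul_of_nonneg_left (S.integral_gradError_succ_le hξ ht)
    S.params.errorWeight_pos.le
  refine (add_le_add_right h1 _).trans ?_
  have hη := S.boundedMeasurable_step hξ t
  have hinv := S.boundedMeasurable_inv_step hξ t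
  have hinv' := S.boundedMeasurable_inv_step hξ (t - 1)
  have he := (S.boundedMeasurable_gradError hξ t).pow 2
  have hD := (S.boundedMeasurable_delta hξ ht).pow 2
  have hg := (S.boundedMeasurable_gradf hξ (t := t + 1) (by omega)).pow 2
  have hb := (hη.pow 2).const_mul c
  have hF1 := S.boundedMeasurable_F hξ hF (t := t + 1) (by omega)
  have hF0 := S.boundedMeasurable_F hξ hF ht
  have hΔ : BoundedMeasurable fun o => ‖x (t + 1) o - x t o‖ := by
    have : (fun o => ‖x (t + 1) o - x t o‖)
        = fun o => stepSize p κ w ξ x t o * ‖xhat t o - x t o‖ := funext fun o => by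
      rw [S.x_succ_eq ht, add_sub_cancel_left, norm_smul,
        Real.norm_of_nonneg (stepSize_pos S.params t o).le]
    rw [this]
    exact hη.mul (S.boundedMeasurable_delta hξ ht)
  have hA := (((((BoundedMeasurable.const 1).sub hb).mul he).add
    ((hΔ.pow 2).const_mul (2 * L ^ 2))).add (((hb.pow 2).const_mul 2).mul hg)).mul hinv
  have hB := he.mul hinv'
  have hC := hη.mul (hD.add he)
  have hE := (hη.pow 3).mul hg
  have hB' := hB.const_mul (errorWeight L G κ c)
  have hC' := hC.const_mul (decreaseRate L G κ c)
  have hE' := hE.const_mul (2 * errorWeight L G κ c * c ^ 2)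
  have hmono := integral_mono (μ := Pr) (hF1.add (hA.const_mul (errorWeight L G κ c))).integrable
    (((hF0.add hB').sub hC').add hE').integrable fun o => S.potential_le ht o _
  rwa [integral_add hF1.integrable (hA.const_mul _).integrable, integral_const_mul,
    integral_add ((hF0.add hB').sub hC').integrable hE'.integrable,
    integral_sub (hF0.add hB').integrable hC'.integrable,
    integral_add hF0.integrable hB'.integrable, integral_const_mul, integral_const_mul,
    integral_const_mul] at hmono

/-- The accumulated squared steps and gradient errors, weighted by the step sizes, grow at most
logarithmically. -/
lemma sum_integral_le {B₁ : ℝ} (hB₁ : p.F x₁ - Fstar ≤ B₁) (T : ℕ) :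
    decreaseRate L G κ c * ∑ t ∈ Finset.Icc 1 T, ∫ o, stepSize p κ w ξ x t o
        * (‖xhat t o - x t o‖ ^ 2 + ‖gradError p x z t o‖ ^ 2) ∂Pr
      ≤ B₁ + errorWeight L G κ c * (16 * G ^ 2 * (w ^ (1 / 3 : ℝ) / κ))
        + 4 * errorWeight L G κ c * c ^ 2 * κ ^ 3 * Real.log (T + 2) := by
  have ha := S.params.errorWeight_pos
  have hc := S.params.c_pos
  have htel : ∀ T : ℕ, (∫ o, p.F (x (T + 1) o) ∂Pr) + errorWeight L G κ c
        * (∫ o, ‖gradError p x z (T + 1) o‖ ^ 2 * (stepSize p κ w ξ x T o)⁻¹ ∂Pr)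
      + decreaseRate L G κ c * ∑ t ∈ Finset.Icc 1 T, ∫ o, stepSize p κ w ξ x t o
        * (‖xhat t o - x t o‖ ^ 2 + ‖gradError p x z t o‖ ^ 2) ∂Pr
      ≤ (∫ o, p.F (x 1 o) ∂Pr) + errorWeight L G κ c
        * (∫ o, ‖gradError p x z 1 o‖ ^ 2 * (stepSize p κ w ξ x 0 o)⁻¹ ∂Pr)
        + 2 * errorWeight L G κ c * c ^ 2 * ∑ t ∈ Finset.Icc 1 T, ∫ o, stepSize p κ w ξ x t o ^ 3
            * ‖p.gradf (x (t + 1) o) (ξ (t + 1) o)‖ ^ 2 ∂Pr := by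
    intro T
    induction T with
    | zero => simp
    | succ T ih =>
      rw [Finset.sum_Icc_succ_top (by omega), Finset.sum_Icc_succ_top (by omega)]
      have := S.integral_potential_succ_le hξ hF (t := T + 1) (by omega)
      rw [Nat.add_sub_cancel] at this
      linarith
  have h1 : Fstar ≤ ∫ o, p.F (x (T + 1) o) ∂Pr := by
    have := integral_mono (μ := Pr) (integrable_const Fstar)
      (S.boundedMeasurable_F hξ hF (t := T + 1) (by omega)).integrable
      fun o => hF _ (S.x_mem (T + 1) o)
    simpa using this
  have h2 : 0 ≤ ∫ o, ‖gradError p x z (T + 1) o‖ ^ 2 * (stepSize p κ w ξ x T o)⁻¹ ∂Pr :=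
    integral_nonneg fun o => mul_nonneg (sq_nonneg _)
      (inv_nonneg.2 (stepSize_pos S.params T o).le)
  have h3 : ∫ o, p.F (x 1 o) ∂Pr = p.F x₁ := by
    simp [S.run.x_one]
  have h4 : ∫ o, ‖gradError p x z 1 o‖ ^ 2 * (stepSize p κ w ξ x 0 o)⁻¹ ∂Pr
      ≤ 16 * G ^ 2 * (w ^ (1 / 3 : ℝ) / κ) := by
    have := integral_mono (μ := Pr) (((S.boundedMeasurable_gradError hξ 1).pow 2).mul
      (S.boundedMeasurable_inv_step hξ 0)).integrable
      (integrable_const (16 * G ^ 2 * (w ^ (1 / 3 : ℝ) / κ))) fun o => by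
        have h5 := pow_le_pow_left₀ (norm_nonneg _) (S.norm_gradError_le 1 o) 2
        rw [stepSize_eq, accum_zero, inv_div]
        refine mul_le_mul_of_nonneg_right (h5.trans_eq ?_)
          (div_nonneg S.params.root_pos.le S.params.κ_pos.le)
        push_cast
        ring
    simpa using this
  have h5 : ∑ t ∈ Finset.Icc 1 T, ∫ o, stepSize p κ w ξ x t o ^ 3
      * ‖p.gradf (x (t + 1) o) (ξ (t + 1) o)‖ ^ 2 ∂Pr ≤ 2 * κ ^ 3 * Real.log (T + 2) := by
    have hi : ∀ t ∈ Finset.Icc 1 T, Integrable (fun o => stepSize p κ w ξ x t o ^ 3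
        * ‖p.gradf (x (t + 1) o) (ξ (t + 1) o)‖ ^ 2) Pr := fun t _ =>
      (((S.boundedMeasurable_step hξ t).pow 3).mul
        ((S.boundedMeasurable_gradf hξ (by omega)).pow 2)).integrable
    rw [← integral_finsetSum _ hi]
    have := integral_mono (μ := Pr) (integrable_finsetSum _ hi)
      (integrable_const (2 * κ ^ 3 * Real.log (T + 2)))
      fun o => sum_stepSize_cube_le S.params S.regular T o
    simpa using this
  have h6 := htel T
  have h7 := mul_nonneg ha.le h2
  have h8 := mul_le_mul_of_nonneg_left h4 ha.le
  have h9 := mul_le_mul_of_nonneg_left h5 (by positivity : 0 ≤ 2 * errorWeight L G κ c * c ^ 2)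
  rw [h3] at h6
  linarith

end Setting

/-- The constant in the bound for the mean squared step and gradient error of the best iteration. -/
def rateConst (L G κ w c B₁ : ℝ) : ℝ :=
  (|B₁| + errorWeight L G κ c * (16 * G ^ 2 * (w ^ (1 / 3 : ℝ) / κ))
      + 4 * errorWeight L G κ c * c ^ 2 * κ ^ 3)
    * ((2 * w) ^ (1 / 3 : ℝ) / (κ * decreaseRate L G κ c))

lemma Params.rateConst_nonneg (P : Params L G μ κ w c) (B₁ : ℝ) : 0 ≤ rateConst L G κ w c B₁ := by
  have h1 := P.errorWeight_pos
  have h2 := P.decreaseRate_pos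
  have h3 := P.κ_pos
  have h4 := P.w_pos
  unfold rateConst
  positivity

lemma one_le_log_add_two {T : ℕ} (hT : 1 ≤ T) : 1 ≤ Real.log (T + 2) := by
  have hT' : (1 : ℝ) ≤ T := by exact_mod_cast hT
  rw [Real.le_log_iff_exp_le (by positivity)]
  linarith [Real.exp_one_lt_d9]

/-- Some iteration among the first `T` has small mean squared step and gradient error. -/
lemma Setting.exists_small_step (S : Setting p q L G σ ω ρ μ κ w c B x₁ ξ x xhat z)
    (hξ : IIDSamples p Pr ξ) {Fstar : ℝ} (hF : ∀ y ∈ p.feasible, Fstar ≤ p.F y)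
    [IsProbabilityMeasure Pr] {B₁ : ℝ} (hB₁ : p.F x₁ - Fstar ≤ B₁) {T : ℕ} (hT : 1 ≤ T) :
    ∃ t, 1 ≤ t ∧ t ≤ T ∧
      ∫ o, (‖xhat t o - x t o‖ ^ 2 + ‖gradError p x z t o‖ ^ 2) ∂Pr
        ≤ rateConst L G κ w c B₁ * Real.log (T + 2) * (T : ℝ) ^ (-(2 / 3) : ℝ) := by
  have hw := S.params.w_pos
  have hκ := S.params.κ_pos
  have ha := S.params.errorWeight_pos
  have hθ := S.params.decreaseRate_pos
  have hc := S.params.c_pos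
  have hr := S.params.root_pos
  have hTpos : (0 : ℝ) < T := by exact_mod_cast hT
  have hlog := one_le_log_add_two hT
  set A := |B₁| + errorWeight L G κ c * (16 * G ^ 2 * (w ^ (1 / 3 : ℝ) / κ))
      + 4 * errorWeight L G κ c * c ^ 2 * κ ^ 3 with hA
  set lo := κ / ((2 * w) ^ (1 / 3 : ℝ) * (T : ℝ) ^ (1 / 3 : ℝ)) with hlo
  have hlopos : 0 < lo := by positivity
  have h1 : decreaseRate L G κ c * ∑ t ∈ Finset.Icc 1 T,
      lo * ∫ o, (‖xhat t o - x t o‖ ^ 2 + ‖gradError p x z t o‖ ^ 2) ∂Pr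
      ≤ A * Real.log (T + 2) := by
    have h2 := S.sum_integral_le hξ hF hB₁ T
    have h3 : ∑ t ∈ Finset.Icc 1 T,
        lo * ∫ o, (‖xhat t o - x t o‖ ^ 2 + ‖gradError p x z t o‖ ^ 2) ∂Pr
        ≤ ∑ t ∈ Finset.Icc 1 T, ∫ o, stepSize p κ w ξ x t o
          * (‖xhat t o - x t o‖ ^ 2 + ‖gradError p x z t o‖ ^ 2) ∂Pr := by
      refine Finset.sum_le_sum fun t ht => ?_
      rw [Finset.mem_Icc] at ht
      have hs := ((S.boundedMeasurable_delta hξ ht.1).pow 2).add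
        ((S.boundedMeasurable_gradError hξ t).pow 2)
      rw [← integral_const_mul]
      refine integral_mono (hs.const_mul lo).integrable
        ((S.boundedMeasurable_step hξ t).mul hs).integrable fun o => ?_
      exact mul_le_mul_of_nonneg_right (stepSize_ge S.params S.regular hT ht.2 o) (by positivity)
    refine (mul_le_mul_of_nonneg_left h3 hθ.le).trans (h2.trans ?_)
    have h4 : B₁ + errorWeight L G κ c * (16 * G ^ 2 * (w ^ (1 / 3 : ℝ) / κ))
        ≤ (|B₁| + errorWeight L G κ c * (16 * G ^ 2 * (w ^ (1 / 3 : ℝ) / κ))) * Real.log (T + 2) := by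
      refine le_trans (by gcongr; exact le_abs_self _) (le_mul_of_one_le_right ?_ hlog)
      positivity
    rw [hA, add_mul]
    linarith
  obtain ⟨t, ht, hle⟩ : ∃ t ∈ Finset.Icc 1 T,
      lo * ∫ o, (‖xhat t o - x t o‖ ^ 2 + ‖gradError p x z t o‖ ^ 2) ∂Pr
        ≤ A * Real.log (T + 2) / decreaseRate L G κ c / T := by
    refine Finset.exists_le_of_sum_le ⟨1, Finset.mem_Icc.2 ⟨le_rfl, hT⟩⟩ ?_
    rw [Finset.sum_const, Nat.card_Icc, Nat.add_sub_cancel, nsmul_eq_mul,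
      mul_div_cancel₀ _ hTpos.ne', le_div_iff₀ hθ]
    linarith
  rw [Finset.mem_Icc] at ht
  refine ⟨t, ht.1, ht.2, ?_⟩
  rw [mul_comm, ← le_div_iff₀ hlopos] at hle
  refine hle.trans_eq ?_
  have hpow : (T : ℝ) ^ (-(2 / 3) : ℝ) = (T : ℝ) ^ (1 / 3 : ℝ) / T := by
    rw [← Real.rpow_sub_one hTpos.ne']; norm_num
  rw [hpow, hlo, rateConst, ← hA]
  field_simp

end Potential

/-! ### Approximate KKT points -/

section KKT

variable {n I J : ℕ} {Ξ Ω : Type*} [MeasurableSpace Ξ] [MeasurableSpace Ω]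
  {p : Problem n I J Ξ} {q : Surrogates n J Ξ} {L G σ ω ρ μ κ w c B : ℝ} {x₁ : E n}
  {ξ : ℕ → Ω → Ξ} {x xhat z : ℕ → Ω → E n} {Pr : Measure Ω}

lemma IsEpsKKT.mono {ε ε' : ℝ} (h : ε ≤ ε') {X : Ω → E n} {lam : Ω → Fin J → ℝ}
    {nu : Ω → Fin I → ℝ} (hk : IsEpsKKT p Pr ε X lam nu) : IsEpsKKT p Pr ε' X lam nu := by
  obtain ⟨h1, h2, h3, h4, h5, h6, ⟨v, h7, h8, h9, h10⟩, h11, h12, h13, h14⟩ := hk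
  exact ⟨h1, h2, h3, h4, h5, h6, ⟨v, h7, h8, h9, h10.trans (Real.sqrt_le_sqrt h)⟩, h11,
    (neg_le_neg h).trans h12, h13, (neg_le_neg h).trans h14⟩

/-- The factor between the mean squared step and gradient error of an iteration and the accuracy of
its approximate KKT point; `B / slaterSlack L G ω ρ` bounds the sum of the multipliers. -/
def kktConst (L G ω ρ B : ℝ) : ℝ :=
  1 + (2 * L + 2 * L * (B / slaterSlack L G ω ρ)) ^ 2 + L * (B / slaterSlack L G ω ρ)

/-- An iteration with small mean squared step and gradient error yields an approximate KKT point. -/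
lemma Setting.exists_isEpsKKT (S : Setting p q L G σ ω ρ μ κ w c B x₁ ξ x xhat z)
    (hξ : IIDSamples p Pr ξ) [IsProbabilityMeasure Pr] (hω : 0 < ω) (hρ : 0 < ρ) (hB : 0 ≤ B)
    {t : ℕ} (ht : 1 ≤ t) {ε : ℝ} (hε : 0 < ε)
    (hle : kktConst L G ω ρ B
      * ∫ o, (‖xhat t o - x t o‖ ^ 2 + ‖gradError p x z t o‖ ^ 2) ∂Pr ≤ ε) :
    ∃ (lam : Ω → Fin J → ℝ) (nu : Ω → Fin I → ℝ), IsEpsKKT p Pr ε (xhat t) lam nu := by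
  have hL := S.params.L_pos
  have hG := S.params.G_nonneg
  have hμ : 0 ≤ μ := by linarith [S.params.μ_gt]
  have hp := S.regular
  have hq := S.admissible
  have hslack := slaterSlack_pos hL hG hω hρ
  set Λ := B / slaterSlack L G ω ρ with hΛ
  have hΛ0 : 0 ≤ Λ := div_nonneg hB hslack.le
  set M := 2 * L + 2 * L * Λ with hM
  have hM0 : 0 ≤ M := by positivity
  have hxm := S.measurable_x hξ t
  have hxhm := S.measurable_xhat hξ ht
  have hξm := hξ.measurable t ht
  have hxmem := S.x_mem t
  have hxhmem := fun o => S.xhat_mem ht o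
  -- measurability of the data of the KKT system of the subproblem
  have hcor : Measurable (correction p κ w c ξ x z t) :=
    (measurable_const.sub (((S.measurable_step hξ (t - 1)).pow_const 2).const_mul c)).smul
      ((S.measurable_z hξ ht).sub ((hp.measurable_gradf hG).comp
        ((S.measurable_x hξ (t - 1)).prodMk hξm)))
  have hfh : Measurable fun o => ∇ (fun y => q.fhat y (x t o) (ξ t o)) (xhat t o) :=
    measurable_gradient_of_increments (ψ := fun o y => q.fhat y (x t o) (ξ t o))
      (fun o => (hq.fhat_smooth _ (hxmem o) _).1 _ trivial) fun d =>
      hq.fhat_measurable.comp ((hxhm.add_const d).prodMk (hxm.prodMk hξm))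
  have hcon : ∀ (k : Fin J ⊕ Fin I) (d : E n),
      Measurable fun o => subConstraint p q (x t o) k (xhat t o + d) := by
    rintro (j | i) d
    · exact (hq.gtil_measurable j).comp ((hxhm.add_const d).prodMk hxm)
    · exact ((hp.h_lipschitz i).continuous hG).measurable.comp (hxhm.add_const d)
  have hcong : ∀ k : Fin J ⊕ Fin I,
      Measurable fun o => ∇ (subConstraint p q (x t o) k) (xhat t o) := fun k =>
    measurable_gradient_of_increments
      (fun o => hq.subConstraint_differentiableAt hp (hxmem o) (hxhmem o) k) (hcon k)
  obtain ⟨l, hlm, hl⟩ := exists_measurable_multipliers (D := p.dom) (u := p.u) (a := xhat t)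
    (v := fun o => ∇ (fun y => q.fhat y (x t o) (ξ t o)) (xhat t o) + correction p κ w c ξ x z t o)
    (c := fun k o => subConstraint p q (x t o) k (xhat t o))
    (w := fun k o => ∇ (subConstraint p q (x t o) k) (xhat t o)) (Λ := Λ)
    ⟨x₁, hp.feasible_subset S.start_mem⟩ hxhm
    (S.measurable_u_comp hxhm fun o => hp.feasible_subset (hxhmem o)) (hfh.add hcor)
    (fun k => by simpa using hcon k 0) hcong
    (fun k o => by
      have := S.run.xhat_mem t ht o
      rw [subFeasible_eq] at this
      exact this k)
    (fun o => hq.exists_multipliers hp hL hG hμ hω hρ (hxmem o) (S.run.xhat_mem t ht o)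
      (S.isMinOn ht o) fun y hy => S.gap_le ht o hy)
  have hlk : ∀ k, Measurable fun o => l o k := fun k => (measurable_pi_apply k).comp hlm
  have hgU : Measurable fun o => ∇ p.U (xhat t o) :=
    ((hp.smoothOn_U hG).continuous_gradient hL.le).measurable.comp hxhm
  have hgg : ∀ j, Measurable fun o => ∇ (p.g j) (xhat t o) := fun j =>
    ((hp.g_smooth j).continuous_gradient hL.le).measurable.comp hxhm
  have hgh : ∀ i, Measurable fun o => ∇ (p.h i) (xhat t o) := fun i =>
    ((hp.h_smooth i).continuous_gradient hL.le).measurable.comp hxhm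
  set v : Ω → E n := fun o => -(∇ (fun y => q.fhat y (x t o) (ξ t o)) (xhat t o)
    + correction p κ w c ξ x z t o
    + ∑ k, l o k • ∇ (subConstraint p q (x t o) k) (xhat t o)) with hv
  have hvm : Measurable v := ((hfh.add hcor).add
    (Finset.measurable_sum _ fun k _ => (hlk k).smul (hcong k))).neg
  set res : Ω → E n := fun o => ∇ p.U (xhat t o) + ∑ j, l o (Sum.inl j) • ∇ (p.g j) (xhat t o)
    + ∑ i, l o (Sum.inr i) • ∇ (p.h i) (xhat t o) + v o with hres
  have hresm : Measurable res := ((hgU.add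
    (Finset.measurable_sum _ fun j _ => (hlk (Sum.inl j)).smul (hgg j))).add
    (Finset.measurable_sum _ fun i _ => (hlk (Sum.inr i)).smul (hgh i))).add hvm
  have hrle : ∀ o, ‖res o‖ ≤ ‖gradError p x z t o‖ + M * ‖xhat t o - x t o‖ := by
    intro o
    have := hq.norm_residual_le (s := ξ t o) (b := correction p κ w c ξ x z t o) hp hL hG (hxmem o)
      (hxhmem o) (hl o).1 (hl o).2.2.1
    rwa [← S.z_succ_eq ht] at this
  have hbe := S.boundedMeasurable_gradError hξ t
  have hbd := S.boundedMeasurable_delta hξ ht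
  have hbr := hbe.add (hbd.const_mul M)
  have hsq := (hbd.pow 2).add (hbe.pow 2)
  have hint0 : 0 ≤ ∫ o, (‖xhat t o - x t o‖ ^ 2 + ‖gradError p x z t o‖ ^ 2) ∂Pr :=
    integral_nonneg fun o => by positivity
  have hresi : Integrable (fun o => ‖res o‖) Pr :=
    hbr.integrable.mono' hresm.norm.aestronglyMeasurable
      (Filter.Eventually.of_forall fun o => by rw [norm_norm]; exact hrle o)
  have hK1 : (1 + M ^ 2) * ∫ o, (‖xhat t o - x t o‖ ^ 2 + ‖gradError p x z t o‖ ^ 2) ∂Pr ≤ ε := by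
    refine (mul_le_mul_of_nonneg_right ?_ hint0).trans hle
    rw [kktConst, ← hΛ, ← hM]
    exact le_add_of_nonneg_right (by positivity)
  have hK2 : L * Λ * ∫ o, (‖xhat t o - x t o‖ ^ 2 + ‖gradError p x z t o‖ ^ 2) ∂Pr ≤ ε := by
    refine (mul_le_mul_of_nonneg_right ?_ hint0).trans hle
    rw [kktConst, ← hΛ, ← hM]
    exact le_add_of_nonneg_left (by positivity)
  -- the first moment is bounded through the second by `r ≤ (r² / √ε + √ε) / 2`
  have hsε : 0 < √ε := Real.sqrt_pos.2 hε
  have hresle : ∫ o, ‖res o‖ ∂Pr ≤ √ε := by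
    have hB1 : BoundedMeasurable fun o : Ω => (1 + M ^ 2) / (2 * √ε)
        * (‖xhat t o - x t o‖ ^ 2 + ‖gradError p x z t o‖ ^ 2) := hsq.const_mul _
    have h1 : ∫ o, ‖res o‖ ∂Pr ≤ ∫ o, ((1 + M ^ 2) / (2 * √ε)
        * (‖xhat t o - x t o‖ ^ 2 + ‖gradError p x z t o‖ ^ 2) + √ε / 2) ∂Pr := by
      refine integral_mono hresi (hB1.add (BoundedMeasurable.const _)).integrable fun o => ?_
      refine (hrle o).trans ?_
      set a := ‖gradError p x z t o‖
      set d := ‖xhat t o - x t o‖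
      have h2 : (a + M * d) ^ 2 ≤ (1 + M ^ 2) * (d ^ 2 + a ^ 2) := by
        nlinarith [sq_nonneg (M * a - d)]
      have h3 : (1 + M ^ 2) / (2 * √ε) * (d ^ 2 + a ^ 2) + √ε / 2
          = ((1 + M ^ 2) * (d ^ 2 + a ^ 2) + √ε ^ 2) / (2 * √ε) := by
        field_simp
      rw [h3, le_div_iff₀ (by positivity)]
      nlinarith [sq_nonneg (a + M * d - √ε)]
    rw [integral_add hB1.integrable (integrable_const _), integral_const_mul, integral_const,
      probReal_univ, one_smul] at h1
    refine h1.trans ?_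
    have h4 : (1 + M ^ 2) / (2 * √ε)
        * ∫ o, (‖xhat t o - x t o‖ ^ 2 + ‖gradError p x z t o‖ ^ 2) ∂Pr ≤ √ε / 2 := by
      rw [div_mul_eq_mul_div, div_le_iff₀ (by positivity)]
      refine hK1.trans_eq ?_
      have := Real.mul_self_sqrt hε.le
      linarith
    linarith
  have hlg : ∀ o, -(L * Λ * ‖xhat t o - x t o‖ ^ 2)
      ≤ ∑ j, l o (Sum.inl j) * p.g j (xhat t o) := fun o =>
    hq.sum_mul_g_ge hp hL (hxmem o) (S.run.xhat_mem t ht o) (hl o).1 (hl o).2.2.1 (hl o).2.1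
  have hlg0 : ∀ o, ∑ j, l o (Sum.inl j) * p.g j (xhat t o) ≤ 0 := fun o =>
    Finset.sum_nonpos fun j _ => mul_nonpos_of_nonneg_of_nonpos ((hl o).1 _) ((hxhmem o).2 j)
  have hb2 := (hbd.pow 2).const_mul (L * Λ)
  have hlgi : Integrable (fun o => ∑ j, l o (Sum.inl j) * p.g j (xhat t o)) Pr := by
    refine hb2.integrable.mono' (Measurable.aestronglyMeasurable ?_)
      (Filter.Eventually.of_forall fun o => ?_)
    · exact Finset.measurable_sum _ fun j _ => (hlk _).mul
        (((hp.g_lipschitz j).continuous hG).measurable.comp hxhm)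
    · rw [Real.norm_of_nonpos (hlg0 o)]
      linarith [hlg o]
  have hνh : (fun o => ∑ i, l o (Sum.inr i) * p.h i (xhat t o)) = fun _ => 0 :=
    funext fun o => Finset.sum_eq_zero fun i _ => (hl o).2.1 (Sum.inr i)
  refine ⟨fun o j => l o (Sum.inl j), fun o i => l o (Sum.inr i), hxhm,
    measurable_pi_lambda _ fun j => hlk _, measurable_pi_lambda _ fun i => hlk _, hxhmem,
    fun o j => (hl o).1 _, fun o i => (hl o).1 _,
    ⟨v, hvm, fun o => ⟨hp.feasible_subset (hxhmem o), (hl o).2.2.2⟩, hresi, hresle⟩, hlgi, ?_, ?_, ?_⟩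
  · have h1 := integral_mono (μ := Pr) hb2.integrable.neg hlgi fun o => hlg o
    refine le_trans ?_ h1
    have h2 : ∫ o, ‖xhat t o - x t o‖ ^ 2 ∂Pr
        ≤ ∫ o, (‖xhat t o - x t o‖ ^ 2 + ‖gradError p x z t o‖ ^ 2) ∂Pr :=
      integral_mono (hbd.pow 2).integrable hsq.integrable
        fun o => le_add_of_nonneg_right (sq_nonneg _)
    have h3 := mul_le_mul_of_nonneg_left h2 (by positivity : 0 ≤ L * Λ)
    simp only [Pi.neg_apply]
    rw [integral_neg, integral_const_mul]
    linarith
  · rw [hνh]; exact integrable_zero _ _ _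
  · rw [hνh]; simpa using hε.le

/-- The number of iterations after which the rate `log T / T ^ (2/3)` falls below `ε`. -/
lemma exists_iterations {C : ℝ} (hC : 0 < C) :
    ∃ C' : ℝ, 0 < C' ∧ ∀ ε : ℝ, 0 < ε → ε < 1 → ∃ T : ℕ, 1 ≤ T ∧
      2 * (T : ℝ) ≤ C' * ε ^ (-(3 / 2) : ℝ) * (1 + Real.log (1 / ε)) ^ (3 / 2 : ℝ) ∧
      C * Real.log (T + 2) * (T : ℝ) ^ (-(2 / 3) : ℝ) ≤ ε := by
  set a := max 1 (8 * C) with ha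
  have ha1 : 1 ≤ a := le_max_left _ _
  have haC : 8 * C ≤ a := le_max_right _ _
  have ha0 : 0 < a := by linarith
  refine ⟨4 * a ^ 3, by positivity, fun ε hε hε1 => ?_⟩
  set l := 1 + Real.log (1 / ε) with hl
  have hlog0 : 0 ≤ Real.log (1 / ε) := Real.log_nonneg (by rw [le_div_iff₀ hε]; linarith)
  have hl1 : 1 ≤ l := by linarith
  have hl0 : 0 < l := by linarith
  set X := ε ^ (-(3 / 2) : ℝ) * l ^ (3 / 2 : ℝ) with hX
  have hX1 : 1 ≤ X := by
    have h1 : 1 ≤ ε ^ (-(3 / 2) : ℝ) := Real.one_le_rpow_of_pos_of_le_one_of_nonpos hε hε1.le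
      (by norm_num)
    have h2 : 1 ≤ l ^ (3 / 2 : ℝ) := Real.one_le_rpow hl1 (by norm_num)
    exact one_le_mul_of_one_le_of_one_le h1 h2
  have hX0 : 0 < X := by linarith
  have ha3 : 1 ≤ a ^ 3 := one_le_pow₀ ha1
  have hY1 : 1 ≤ a ^ 3 * X := one_le_mul_of_one_le_of_one_le ha3 hX1
  have hle := Nat.le_ceil (a ^ 3 * X)
  have hlt := Nat.ceil_lt_add_one (a := a ^ 3 * X) (by linarith)
  set T := ⌈a ^ 3 * X⌉₊ with hT
  have hT1 : (1 : ℝ) ≤ T := hY1.trans hle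
  refine ⟨T, by exact_mod_cast hT1, ?_, ?_⟩
  · rw [mul_assoc, ← hX]; linarith
  · have h1 : (T : ℝ) ^ (-(2 / 3) : ℝ) ≤ (a ^ 3 * X) ^ (-(2 / 3) : ℝ) :=
      Real.rpow_le_rpow_of_nonpos (by linarith) hle (by norm_num)
    have h2 : (a ^ 3 * X) ^ (-(2 / 3) : ℝ) = ε / (a ^ 2 * l) := by
      rw [Real.mul_rpow (by positivity) hX0.le, hX,
        Real.mul_rpow (Real.rpow_nonneg hε.le _) (Real.rpow_nonneg hl0.le _),
        ← Real.rpow_mul hε.le, ← Real.rpow_mul hl0.le, ← Real.rpow_natCast a 3,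
        ← Real.rpow_mul ha0.le]
      have e1 : (-(3 / 2) : ℝ) * (-(2 / 3)) = 1 := by norm_num
      have e2 : (3 / 2 : ℝ) * (-(2 / 3)) = -1 := by norm_num
      have e3 : ((3 : ℕ) : ℝ) * (-(2 / 3)) = -((2 : ℕ) : ℝ) := by norm_num
      rw [e1, e2, e3, Real.rpow_one, Real.rpow_neg_one, Real.rpow_neg ha0.le, Real.rpow_natCast]
      field_simp
    have h3 : Real.log (T + 2) ≤ 8 * a * l := by
      have h4 : Real.log (T + 2) ≤ Real.log (4 * a ^ 3 * X) :=
        Real.log_le_log (by linarith) (by linarith)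
      have hε0 : 0 < ε ^ (-(3 / 2) : ℝ) := Real.rpow_pos_of_pos hε _
      have hlp : 0 < l ^ (3 / 2 : ℝ) := Real.rpow_pos_of_pos hl0 _
      rw [Real.log_mul (by positivity) hX0.ne', Real.log_mul (by norm_num) (by positivity),
        Real.log_pow, hX, Real.log_mul hε0.ne' hlp.ne', Real.log_rpow hε, Real.log_rpow hl0] at h4
      have h5 : Real.log ε = 1 - l := by rw [hl, one_div, Real.log_inv]; ring
      have h6 := Real.log_le_sub_one_of_pos hl0
      have h7 := Real.log_le_sub_one_of_pos ha0
      have h8 := Real.log_le_sub_one_of_pos (by norm_num : (0 : ℝ) < 4)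
      rw [h5] at h4
      push_cast at h4
      have h9 : 0 ≤ (a - 1) * (l - 1) := mul_nonneg (by linarith) (by linarith)
      nlinarith
    have h10 : 0 ≤ Real.log (T + 2) := Real.log_nonneg (by linarith)
    calc C * Real.log (T + 2) * (T : ℝ) ^ (-(2 / 3) : ℝ)
        ≤ C * (8 * a * l) * (ε / (a ^ 2 * l)) := by
          rw [← h2]
          gcongr
      _ = 8 * C / a * ε := by field_simp
      _ ≤ 1 * ε := by
          gcongr
          rwa [div_le_one ha0]
      _ = ε := one_mul ε

end KKT

end CoSTA

end

theorem theorem2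
    (L G σ μ ω ρ B₁ B_U κ w c : ℝ)
    (hL : 0 < L) (hG : 0 ≤ G) (hμ : 3 / 4 < μ) (hω : 0 < ω) (hρ : 0 < ρ)
    (hκ : 0 < κ) (hκw : κ ≤ w ^ (1 / 3 : ℝ))
    (hc_upper : c ≤ w ^ (2 / 3 : ℝ) / (4 * κ ^ 2))
    (hc_lower : 4 * L ^ 2 + G ^ 2 / (6 * L * κ ^ 3) < c)
    (hw : max ((2 * L * κ / (4 * μ - 3)) ^ 3) (G ^ 2) ≤ w) :
    ∃ C : ℝ, 0 < C ∧
      ∀ (n I J : ℕ) (Ξ Ω : Type*) [MeasurableSpace Ξ] [MeasurableSpace Ω]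
        (Pr : MeasureTheory.Measure Ω) [MeasureTheory.IsProbabilityMeasure Pr]
        (p : CoSTA.Problem n I J Ξ) (q : CoSTA.Surrogates n J Ξ)
        (x₁ : CoSTA.E n) (Fstar : ℝ)
        (ξ : ℕ → Ω → Ξ) (x xhat z : ℕ → Ω → CoSTA.E n),
        p.Regular L G σ ω ρ →
        q.Admissible p L G μ →
        x₁ ∈ p.feasible → IsGLB (p.F '' p.feasible) Fstar → p.F x₁ - Fstar ≤ B₁ →
        CoSTA.IIDSamples p Pr ξ →
        CoSTA.IsRun p q κ w c x₁ ξ x xhat z →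
        CoSTA.SubObjectiveBounded p q κ w c B_U ξ x z →
        (∀ ε : ℝ, 0 < ε → ε < 1 →
          ∃ t : ℕ, 1 ≤ t ∧
            (t : ℝ) ≤ C * ε ^ (-(3 / 2) : ℝ) * (1 + Real.log (1 / ε)) ^ (3 / 2 : ℝ) ∧
            (∀ o, ((CoSTA.oracleQueries ξ x t o).length : ℝ)
              ≤ C * ε ^ (-(3 / 2) : ℝ) * (1 + Real.log (1 / ε)) ^ (3 / 2 : ℝ)) ∧
            ∃ (lam : Ω → Fin J → ℝ) (nu : Ω → Fin I → ℝ),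
              CoSTA.IsEpsKKT p Pr ε (xhat t) lam nu) ∧
        (∀ T : ℕ, 1 ≤ T →
          ∃ t : ℕ, 1 ≤ t ∧ t ≤ T ∧
            ∃ (lam : Ω → Fin J → ℝ) (nu : Ω → Fin I → ℝ),
              CoSTA.IsEpsKKT p Pr (C * Real.log (T + 2) * (T : ℝ) ^ (-(2 / 3) : ℝ))
                (xhat t) lam nu) := by
  have P : CoSTA.Params L G μ κ w c := ⟨hL, hG, hμ, hκ, hκw, hc_upper, hc_lower, hw⟩
  set C₂ := CoSTA.kktConst L G ω ρ |B_U| * CoSTA.rateConst L G κ w c B₁ + 1 with hC₂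
  have hslack := CoSTA.slaterSlack_pos hL hG hω hρ
  have hK : 0 ≤ CoSTA.kktConst L G ω ρ |B_U| := by
    unfold CoSTA.kktConst
    positivity
  have hC₂pos : 0 < C₂ := by
    have := mul_nonneg hK (P.rateConst_nonneg B₁)
    linarith
  obtain ⟨C₁, hC₁, hiter⟩ := CoSTA.exists_iterations hC₂pos
  refine ⟨max C₁ C₂, lt_max_of_lt_left hC₁, ?_⟩
  intro n I J Ξ Ω _ _ Pr _ p q x₁ Fstar ξ x xhat z hp hq hx₁ hF hB₁ hξ hrun hbdd
  have S : CoSTA.Setting p q L G σ ω ρ μ κ w c |B_U| x₁ ξ x xhat z :=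
    ⟨P, hp, hq, hx₁, hrun, fun t ht o y hy y' hy' =>
      (hbdd t ht o y hy y' hy').trans (le_abs_self _)⟩
  have hFle : ∀ y ∈ p.feasible, Fstar ≤ p.F y := fun y hy => hF.1 ⟨y, hy, rfl⟩
  have main : ∀ T : ℕ, 1 ≤ T → ∃ t : ℕ, 1 ≤ t ∧ t ≤ T ∧
      ∃ (lam : Ω → Fin J → ℝ) (nu : Ω → Fin I → ℝ),
        CoSTA.IsEpsKKT p Pr (C₂ * Real.log (T + 2) * (T : ℝ) ^ (-(2 / 3) : ℝ)) (xhat t) lam nu := by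
    intro T hT
    obtain ⟨t, ht1, htT, hsmall⟩ := S.exists_small_step hξ hFle hB₁ hT
    have hTpos : (0 : ℝ) < T := by exact_mod_cast hT
    have hlog := CoSTA.one_le_log_add_two hT
    have hr : 0 < Real.log (T + 2) * (T : ℝ) ^ (-(2 / 3) : ℝ) :=
      mul_pos (by linarith) (Real.rpow_pos_of_pos hTpos _)
    refine ⟨t, ht1, htT, S.exists_isEpsKKT hξ hω hρ (abs_nonneg _) ht1 ?_ ?_⟩
    · rw [mul_assoc]; exact mul_pos hC₂pos hr
    · refine (mul_le_mul_of_nonneg_left hsmall hK).trans ?_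
      rw [hC₂, add_mul, add_mul]
      linarith
  refine ⟨fun ε hε hε1 => ?_, fun T hT => ?_⟩
  · obtain ⟨T, hT, hTle, hTε⟩ := hiter ε hε hε1
    obtain ⟨t, ht1, htT, lam, nu, hk⟩ := main T hT
    have hX : 0 ≤ ε ^ (-(3 / 2) : ℝ) * (1 + Real.log (1 / ε)) ^ (3 / 2 : ℝ) := by
      have hlog0 : 0 ≤ Real.log (1 / ε) := Real.log_nonneg (by rw [le_div_iff₀ hε]; linarith)
      positivity
    have hbound : 2 * (t : ℝ)
        ≤ max C₁ C₂ * ε ^ (-(3 / 2) : ℝ) * (1 + Real.log (1 / ε)) ^ (3 / 2 : ℝ) := by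
      have h1 : (t : ℝ) ≤ T := by exact_mod_cast htT
      have h2 := mul_le_mul_of_nonneg_right (le_max_left C₁ C₂) hX
      rw [mul_assoc] at hTle ⊢
      linarith
    refine ⟨t, ht1, ?_, fun o => ?_, lam, nu, hk.mono hTε⟩
    · have : (0 : ℝ) ≤ t := Nat.cast_nonneg t
      linarith
    · have hlen : ((CoSTA.oracleQueries ξ x t o).length : ℝ) = 2 * t := by
        simp [CoSTA.oracleQueries, List.length_flatMap, mul_comm]
      rw [hlen]
      exact hbound
  · obtain ⟨t, ht1, htT, lam, nu, hk⟩ := main T hT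
    refine ⟨t, ht1, htT, lam, nu, hk.mono ?_⟩
    have hlog := CoSTA.one_le_log_add_two hT
    rw [mul_assoc, mul_assoc]
    refine mul_le_mul_of_nonneg_right (le_max_right _ _) ?_
    exact mul_nonneg (by linarith) (Real.rpow_nonneg (Nat.cast_nonneg T) _)
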